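/- Write $\mathbb Z^+=\{0,1,2,\dots\}$. A probability on $\mathbb Z^+$ is a function $F\colon\mathbb Z^+\to[0,\infty)$ with $\sum_{k\ge 0}F(k)=1$. Let $F^{(n)}$ denote its $n$-fold convolution power, and let $\widehat F(\xi)=\sum_{k\ge0}F(k)e^{-ik\xi}$ for real $\xi$. Let $\mathcal A$ be the set of probabilities $F$ on $\mathbb Z^+$ with $$\sup_{n\ge1}\, n\sum_{k\ge0}\bigl|F^{(n)}(k)-F^{(n+1)}(k)\bigr|<\infty .$$ Call $F$ aperiodic if, for every $m\in\mathbb Z$, the set $\{m+k : F(k)\ne0\}$ generates the additive group $\mathbb Z$. **Theorem 5.5.** Let $F$ be a probability on $\mathbb Z^+$ such that $$F(k)=\sum_{j=1}^N c_j\,k^{-1-\alpha_j}+P(k)\qquad\text{for all integers } k\ge1,$$ where $N\ge1$, $0<\alpha_1<\cdots<\alpha_N<1$, $c_1,\dots,c_N>0$, and $P\colon\mathbb Z^+\to\mathbb R$ satisfies $\sum_{k\ge1}k|P(k)|<\infty$. Then, with $\alpha=\alpha_1$: 1. $F$ is aperiodic, and there exist $\varepsilon\in(0,1)$ and $c>0$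 such that $1-\operatorname{Re}\widehat F(\xi)\ge\varepsilon|\xi|^{\alpha}$ for all $\xi\in[-\varepsilon,\varepsilon]$, and $\widehat F$ is differentiable at $\xi$ with $|\partial_\xi\widehat F(\xi)|\le c|\xi|^{\alpha-1}$ for all $\xi\in[-\pi,\pi]\setminus\{0\}$. 2. $F\in\mathcal A$. -/

import Mathlib

open scoped ENNReal

namespace RittProbability

/-- `F : ℤ⁺ → ℝ` (with `ℤ⁺ = {0, 1, 2, …}`) is a probability: nonnegative with total mass `1`. -/
structure IsProbability (F : ℕ → ℝ) : Prop where
  nonneg : ∀ k, 0 ≤ F k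
  hasSum : HasSum F 1

/-- The Dirac mass `δ₀`, the unit for convolution. -/
def dirac : ℕ → ℝ := fun k => if k = 0 then 1 else 0

/-- Convolution of two functions supported on `ℤ⁺`:
`(F * G)(m) = ∑_{k ∈ ℤ} F(k) G(m - k) = ∑_{k + l = m} F(k) G(l)`. -/
def conv (F G : ℕ → ℝ) : ℕ → ℝ :=
  fun m => ∑ p ∈ Finset.HasAntidiagonal.antidiagonal m, F p.1 * G p.2

/-- The convolution power `F^{(n)} = F * ⋯ * F` (`n` factors), with `F^{(0)} = δ₀`. -/
def convPow (F : ℕ → ℝ) : ℕ → (ℕ → ℝ)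
  | 0 => dirac
  | n + 1 => conv (convPow F n) F

/-- The `L¹` norm, with value `∞` when the function is not summable. -/
noncomputable def l1Norm (F : ℕ → ℝ) : ℝ≥0∞ := ∑' k, ‖F k‖ₑ

/-- The class of Ritt probabilities on `ℤ⁺`: the probabilities `F` such that
`sup_{n ≥ 1} n ‖F^{(n)} - F^{(n+1)}‖_{L¹} < ∞`. -/
def rittClass : Set (ℕ → ℝ) :=
  {F | IsProbability F ∧
    ⨆ (n : ℕ) (_ : 1 ≤ n), (n : ℝ≥0∞) * l1Norm (convPow F n - convPow F (n + 1)) < ∞}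

/-- The support, as a subset of `ℤ`, of the translate `δ_m * F` of `F` by `m ∈ ℤ`. -/
def translateSupport (F : ℕ → ℝ) (m : ℤ) : Set ℤ :=
  {z | ∃ k : ℕ, F k ≠ 0 ∧ z = m + (k : ℤ)}

/-- `F` is aperiodic: every translate `δ_m * F`, `m ∈ ℤ`, is adapted, that is, its support
generates the additive group `ℤ`. -/
def IsAperiodic (F : ℕ → ℝ) : Prop :=
  ∀ m : ℤ, AddSubgroup.closure (translateSupport F m) = ⊤

/-- The Fourier transform `F̂(ξ) = ∑_{k ≥ 0} F(k) e^{-ikξ}`. -/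
noncomputable def fourierZ (F : ℕ → ℝ) (ξ : ℝ) : ℂ :=
  ∑' k : ℕ, (F k : ℂ) * Complex.exp (-(Complex.I * (k : ℂ) * (ξ : ℂ)))

/-- The sufficient criterion of order `α` for a probability `F` on `ℤ⁺` to be Ritt: `F` is
aperiodic, `1 - Re F̂(ξ) ≥ ε |ξ|^α` for `|ξ| ≤ ε`, and `F̂` is differentiable with
`|∂_ξ F̂(ξ)| ≤ c |ξ|^{α - 1}` for `0 < |ξ| ≤ π`. -/
structure FourierCriterion (α : ℝ) (F : ℕ → ℝ) : Prop where
  isProbability : IsProbability F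
  aperiodic : IsAperiodic F
  bounds : ∃ ε : ℝ, 0 < ε ∧ ε < 1 ∧ ∃ c : ℝ, 0 < c ∧
    (∀ ξ ∈ Set.Icc (-ε) ε, ε * |ξ| ^ α ≤ 1 - (fourierZ F ξ).re) ∧
    (∀ ξ ∈ Set.Icc (-Real.pi) Real.pi, ξ ≠ 0 →
      DifferentiableAt ℝ (fourierZ F) ξ ∧ ‖deriv (fourierZ F) ξ‖ ≤ c * |ξ| ^ (α - 1))

end RittProbability

/-! Everything is read off the behaviour of `φ = F̂` near `0`. The formal derivative of `∑
k^{-1-α_j} e^{-ikξ}` is `-i ∑ k^{-α_j} e^{-ikξ}`. The first `~1/|ξ|` terms of that sum are bounded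
absolutely and the tail by Abel summation, which gives `O(|ξ|^{α_j-1})`. The remainder `P`
contributes a `C¹` function, so the smallest exponent `α` dominates. Conversely, the terms with `k ~
1/|ξ|` alone force `1 - Re φ ≳ |ξ|^α`, while `P` can only cost `O(|ξ|)`. Finally `F` charges two
consecutive integers, since otherwise `∑ k^{-α}` would be controlled by `∑ k|P(k)|`; aperiodicity
follows, and so does `|φ| < 1` away from `0`.

For the Ritt property, integrating the derivative bound gives `|1 - φ| ≲ |ξ|^α`. With the lower
bound and compactness this yields `|φ| ≤ exp(-c|ξ|^α)`. Hence `ψ = φ^n (1 - φ)`, the transform of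
`F^{(n)} - F^{(n+1)}`, has size `1/n` and frequency scale `1/M`, where `M = n^{1/α}`. Coefficients
with `k ≲ M` are handled by Bessel and Cauchy-Schwarz (`sum_low_block_le`).

For larger `k`, `ψ'` need not be square integrable at `0`, so increments replace derivatives. If
`|ψ| ≤ A|ξ|^b` and `|ψ'| ≤ A|ξ|^{b-1}` with `b < 1/2`, then `ψ(· + h) - ψ` has `L²` norm `O(A
h^{b+1/2})`. With `h = 1/N` this bounds the `ℓ¹` norm of the block `[N, 2N)` by `O(A N^{-b})`
(`sum_dyadic_block_le`), and the dyadic sum over `N ≥ M` is `O(A M^{-b})`. The choice `b = α/2`, for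
which `A ~ n^{-1/2}`, makes this `O(1/n)`. -/

namespace RittProbability

/-! ### Fourier series of summable sequences: characters, derivatives, convolution, modulation. -/

/-- The Fourier series `∑_{k ≥ 0} f(k) e^{-ikξ}` with complex coefficients. -/
noncomputable def fourierC (f : ℕ → ℂ) (ξ : ℝ) : ℂ :=
  ∑' k : ℕ, f k * Complex.exp (-(Complex.I * (k : ℂ) * (ξ : ℂ)))

theorem fourierZ_eq (F : ℕ → ℝ) : fourierZ F = fourierC (fun k => (F k : ℂ)) := rfl

theorem norm_char (k : ℕ) (ξ : ℝ) : ‖Complex.exp (-(Complex.I * (k : ℂ) * (ξ : ℂ)))‖ = 1 := by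
  rw [show -(Complex.I * (k : ℂ) * (ξ : ℂ)) = ((-(k * ξ) : ℝ) : ℂ) * Complex.I by push_cast; ring]
  exact Complex.norm_exp_ofReal_mul_I _

theorem char_eq_pow (k : ℕ) (ξ : ℝ) :
    Complex.exp (-(Complex.I * (k : ℂ) * (ξ : ℂ))) = Complex.exp (-(Complex.I * (ξ : ℂ))) ^ k := by
  rw [← Complex.exp_nat_mul]; congr 1; ring

theorem norm_exp_neg_I (ξ : ℝ) : ‖Complex.exp (-(Complex.I * (ξ : ℂ)))‖ = 1 := by
  simpa using norm_char 1 ξ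

theorem char_re (k : ℕ) (ξ : ℝ) :
    (Complex.exp (-(Complex.I * (k : ℂ) * (ξ : ℂ)))).re = Real.cos (k * ξ) := by
  rw [show -(Complex.I * (k : ℂ) * (ξ : ℂ)) = ((-(k * ξ) : ℝ) : ℂ) * Complex.I by push_cast; ring,
    Complex.exp_ofReal_mul_I_re, Real.cos_neg]

theorem summable_fourierC {f : ℕ → ℂ} (hf : Summable fun k => ‖f k‖) (ξ : ℝ) :
    Summable fun k : ℕ => f k * Complex.exp (-(Complex.I * (k : ℂ) * (ξ : ℂ))) := by
  refine Summable.of_norm ?_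
  simpa [norm_char] using hf

theorem norm_fourierC_le {f : ℕ → ℂ} (hf : Summable fun k => ‖f k‖) (ξ : ℝ) :
    ‖fourierC f ξ‖ ≤ ∑' k, ‖f k‖ := by
  refine tsum_of_norm_bounded hf.hasSum fun k => ?_
  rw [norm_mul, norm_char, mul_one]

theorem continuous_fourierC {f : ℕ → ℂ} (hf : Summable fun k => ‖f k‖) :
    Continuous (fourierC f) := by
  refine continuous_tsum (fun k => by fun_prop) hf fun k ξ => ?_
  rw [norm_mul, norm_char, mul_one]

theorem fourierC_periodic (f : ℕ → ℂ) : Function.Periodic (fourierC f) (2 * Real.pi) := by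
  intro ξ
  refine tsum_congr fun k => ?_
  congr 1
  rw [Complex.exp_eq_exp_iff_exists_int]
  exact ⟨-k, by push_cast; ring⟩

theorem hasDerivAt_char (k : ℕ) (ξ : ℝ) :
    HasDerivAt (fun x : ℝ => Complex.exp (-(Complex.I * (k : ℂ) * (x : ℂ))))
      (-(Complex.I * k) * Complex.exp (-(Complex.I * (k : ℂ) * (ξ : ℂ)))) ξ := by
  have h : HasDerivAt (fun x : ℝ => -(Complex.I * (k : ℂ) * (x : ℂ))) (-(Complex.I * k)) ξ := by
    simpa using ((hasDerivAt_id ξ).ofReal_comp.const_mul (-(Complex.I * (k : ℂ))))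
  simpa [mul_comm] using h.cexp

theorem hasDerivAt_fourierC {f : ℕ → ℂ} (hf : Summable fun k => ‖f k‖)
    (hf1 : Summable fun k : ℕ => (k : ℝ) * ‖f k‖) (ξ : ℝ) :
    HasDerivAt (fourierC f) (fourierC (fun k => -(Complex.I * k) * f k) ξ) ξ := by
  have := hasDerivAt_tsum (𝕜 := ℝ) (F := ℂ) (y₀ := 0) hf1
    (g := fun (k : ℕ) (x : ℝ) => f k * Complex.exp (-(Complex.I * (k : ℂ) * (x : ℂ))))
    (g' := fun (k : ℕ) (x : ℝ) =>
      f k * (-(Complex.I * k) * Complex.exp (-(Complex.I * (k : ℂ) * (x : ℂ)))))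
    (fun k x => (hasDerivAt_char k x).const_mul (f k))
    (fun k x => le_of_eq (by rw [norm_mul, norm_mul, norm_char]; simp [mul_comm]))
    (summable_fourierC hf 0) ξ
  refine this.congr_deriv (tsum_congr fun k => by ring)

theorem fourierC_conv {F G : ℕ → ℝ} (hF : Summable fun k => ‖F k‖) (hG : Summable fun k => ‖G k‖)
    (ξ : ℝ) : fourierZ (conv F G) ξ = fourierZ F ξ * fourierZ G ξ := by
  unfold fourierZ
  rw [tsum_mul_tsum_eq_tsum_sum_antidiagonal_of_summable_norm
    (by simpa [norm_char] using hF) (by simpa [norm_char] using hG)]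
  refine tsum_congr fun k => ?_
  rw [conv, Complex.ofReal_sum, Finset.sum_mul]
  refine Finset.sum_congr rfl fun p hp => ?_
  rw [← Finset.HasAntidiagonal.mem_antidiagonal.1 hp]
  rw [show -(Complex.I * ((p.1 + p.2 : ℕ) : ℂ) * (ξ : ℂ)) =
    -(Complex.I * (p.1 : ℂ) * (ξ : ℂ)) + -(Complex.I * (p.2 : ℂ) * (ξ : ℂ)) by push_cast; ring,
    Complex.exp_add]
  push_cast
  ring

theorem summable_norm_convPow {F : ℕ → ℝ} (hF : Summable fun k => ‖F k‖) (n : ℕ) :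
    Summable fun k => ‖convPow F n k‖ := by
  induction n with
  | zero =>
    refine summable_of_ne_finset_zero (s := {0}) fun k hk => ?_
    simp only [Finset.mem_singleton] at hk
    simp [convPow, dirac, hk]
  | succ n ih => exact summable_norm_sum_mul_antidiagonal_of_summable_norm ih hF

theorem fourierZ_convPow {F : ℕ → ℝ} (hF : Summable fun k => ‖F k‖) (n : ℕ) (ξ : ℝ) :
    fourierZ (convPow F n) ξ = fourierZ F ξ ^ n := by
  induction n with
  | zero =>
    simp only [convPow, fourierZ, dirac, pow_zero]
    rw [tsum_eq_single 0 (by intro k hk; simp [hk])]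
    simp
  | succ n ih =>
    rw [convPow, fourierC_conv (summable_norm_convPow hF n) hF, ih, pow_succ]

theorem fourierC_sub {f g : ℕ → ℂ} (hf : Summable fun k => ‖f k‖) (hg : Summable fun k => ‖g k‖)
    (ξ : ℝ) : fourierC (fun k => f k - g k) ξ = fourierC f ξ - fourierC g ξ := by
  unfold fourierC
  rw [← (summable_fourierC hf ξ).tsum_sub (summable_fourierC hg ξ)]
  exact tsum_congr fun k => by ring

/-- The increment of a Fourier series is the Fourier series of the modulated coefficients. -/
theorem fourierC_shift {f : ℕ → ℂ} (hf : Summable fun k => ‖f k‖) (ξ h : ℝ) :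
    fourierC (fun k => f k * (Complex.exp (-(Complex.I * (k : ℂ) * (h : ℂ))) - 1)) ξ =
      fourierC f (ξ + h) - fourierC f ξ := by
  unfold fourierC
  rw [← (summable_fourierC hf (ξ + h)).tsum_sub (summable_fourierC hf ξ)]
  refine tsum_congr fun k => ?_
  rw [show -(Complex.I * (k : ℂ) * ((ξ + h : ℝ) : ℂ)) =
    -(Complex.I * (k : ℂ) * (h : ℂ)) + -(Complex.I * (k : ℂ) * (ξ : ℂ)) by push_cast; ring,
    Complex.exp_add]
  ring

/-! ### Orthogonality and Bessel's inequality. -/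

open MeasureTheory in
theorem integral_fourierC_mul_exp {f : ℕ → ℂ} (hf : Summable fun k => ‖f k‖) (m : ℕ) :
    ∫ x in (-Real.pi)..Real.pi, Complex.exp (Complex.I * m * x) * fourierC f x =
      2 * Real.pi * f m := by
  have hpi := Real.pi_pos
  have hsum := intervalIntegral.hasSum_intervalIntegral_of_summable_norm (a := -Real.pi) (b := Real.pi)
    (f := fun k : ℕ => (⟨fun x : ℝ => Complex.exp (Complex.I * m * x) *
      (f k * Complex.exp (-(Complex.I * (k : ℂ) * (x : ℂ)))), by fun_prop⟩ : C(ℝ, ℂ))) (by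
      refine Summable.of_nonneg_of_le (fun _ => norm_nonneg _) (fun k => ?_) hf
      rw [ContinuousMap.norm_le _ (norm_nonneg _)]
      intro x
      have h1 : ‖Complex.exp (Complex.I * m * (x : ℝ))‖ = 1 := by
        rw [show Complex.I * m * ((x : ℝ) : ℂ) = ((m * x : ℝ) : ℂ) * Complex.I by push_cast; ring]
        exact Complex.norm_exp_ofReal_mul_I _
      simp [norm_char, h1])
  have hterm : ∀ k : ℕ, (∫ x in (-Real.pi)..Real.pi, Complex.exp (Complex.I * m * x) *
      (f k * Complex.exp (-(Complex.I * (k : ℂ) * (x : ℂ))))) =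
      if k = m then 2 * Real.pi * f m else 0 := by
    intro k
    have h1 : ∀ x : ℝ, Complex.exp (Complex.I * m * x) *
      (f k * Complex.exp (-(Complex.I * (k : ℂ) * (x : ℂ)))) =
      f k * Complex.exp ((Complex.I * (m - k)) * x) := by
      intro x
      rw [mul_left_comm, ← Complex.exp_add]; congr 2; ring
    simp_rw [h1, intervalIntegral.integral_const_mul]
    split_ifs with hk
    · subst hk
      simp
      ring
    · have hne : Complex.I * ((m : ℂ) - k) ≠ 0 :=
        mul_ne_zero Complex.I_ne_zero (sub_ne_zero.2 (by exact_mod_cast Ne.symm hk))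
      rw [integral_exp_mul_complex hne]
      have : Complex.exp (Complex.I * (m - k) * (Real.pi : ℝ)) =
          Complex.exp (Complex.I * (m - k) * ((-Real.pi : ℝ) : ℂ)) := by
        rw [Complex.exp_eq_exp_iff_exists_int]
        exact ⟨m - k, by push_cast; ring⟩
      rw [this]; simp
  simp only [ContinuousMap.coe_mk, hterm] at hsum
  have h2 := hsum.unique (hasSum_ite_eq m (2 * Real.pi * f m))
  rw [← h2]
  congr 1 with x
  exact (tsum_mul_left).symm

open MeasureTheory in
/-- Bessel's inequality for an absolutely convergent Fourier series. -/
theorem sum_sq_le_integral {f : ℕ → ℂ} (hf : Summable fun k => ‖f k‖) (S : Finset ℕ) :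
    ∑ k ∈ S, ‖f k‖ ^ 2 ≤ ∫ x in (-Real.pi)..Real.pi, ‖fourierC f x‖ ^ 2 := by
  have hpi := Real.pi_pos
  have hab : -Real.pi < Real.pi := by linarith
  have hcont := continuous_fourierC hf
  have hL2 : MemLp (fourierC f) 2 (volume.restrict (Set.Ioc (-Real.pi) Real.pi)) :=
    MemLp.of_bound hcont.aestronglyMeasurable (∑' k, ‖f k‖)
      (Filter.Eventually.of_forall fun x => norm_fourierC_le hf x)
  have hs := hasSum_sq_fourierCoeffOn hab hL2
  have hcoef : ∀ k : ℕ, fourierCoeffOn hab (fourierC f) (-(k : ℤ)) = f k := by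
    intro k
    rw [fourierCoeffOn_eq_integral]
    have : ∀ x : ℝ, fourier (-(-(k : ℤ))) (x : AddCircle (Real.pi - -Real.pi)) • fourierC f x =
        Complex.exp (Complex.I * k * x) * fourierC f x := by
      intro x
      rw [fourier_coe_apply, smul_eq_mul]
      congr 2
      have : (Real.pi : ℂ) ≠ 0 := by exact_mod_cast hpi.ne'
      push_cast
      field_simp
      ring
    simp_rw [this]
    rw [integral_fourierC_mul_exp hf]
    have : (Real.pi : ℂ) ≠ 0 := by exact_mod_cast hpi.ne'
    rw [Complex.real_smul]
    push_cast
    field_simp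
    ring
  have hinj : Function.Injective fun k : ℕ => -(k : ℤ) := fun a b h => by simpa using h
  have h1 := hs.summable.sum_le_tsum (S.map ⟨_, hinj⟩) (fun _ _ => by positivity)
  rw [hs.tsum_eq, Finset.sum_map] at h1
  simp only [Function.Embedding.coeFn_mk, hcoef] at h1
  refine h1.trans ?_
  rw [smul_eq_mul]
  refine mul_le_of_le_one_left
    (intervalIntegral.integral_nonneg hab.le fun x _ => by positivity) ?_
  refine inv_le_one_of_one_le₀ ?_
  linarith [Real.pi_gt_three]

/-! ### Trigonometric series with power weights: Abel summation and differentiability off the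
origin. -/

theorem half_abs_le_norm_one_sub_exp {ξ : ℝ} (hξ : |ξ| ≤ Real.pi) :
    |ξ| / 2 ≤ ‖1 - Complex.exp (-(Complex.I * (ξ : ℂ)))‖ := by
  have h := Complex.norm_exp_I_mul_ofReal_sub_one (-ξ)
  rw [norm_sub_rev, show -(Complex.I * (ξ : ℂ)) = Complex.I * ((-ξ : ℝ) : ℂ) by push_cast; ring, h]
  have h1 : |-ξ / 2| ≤ Real.pi / 2 := by
    rw [abs_div, abs_neg, abs_two]; linarith
  have h2 := Real.mul_abs_le_abs_sin h1
  rw [Real.norm_eq_abs, abs_mul, abs_two]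
  rw [abs_div, abs_neg, abs_two] at h2
  have h3 : 1 / 2 ≤ 2 / Real.pi := by
    rw [div_le_div_iff₀ (by norm_num) Real.pi_pos]; linarith [Real.pi_le_four]
  have h4 : 1 / 2 * (|ξ| / 2) ≤ 2 / Real.pi * (|ξ| / 2) :=
    mul_le_mul_of_nonneg_right h3 (by positivity)
  linarith

/-- Summation by parts: a power sum on the unit disc with decreasing weights. -/
theorem norm_one_sub_mul_sum_le {b : ℕ → ℝ} {m : ℕ} (hb : ∀ k, m ≤ k → b (k + 1) ≤ b k)
    (hb0 : ∀ k, m ≤ k → 0 ≤ b k) {z : ℂ} (hz : ‖z‖ ≤ 1) {n : ℕ} (hn : m ≤ n) :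
    ‖(1 - z) * ∑ k ∈ Finset.Ico m n, (b k : ℂ) * z ^ k‖ ≤ 2 * b m := by
  have hpow : ∀ k : ℕ, ‖z ^ k‖ ≤ 1 := fun k => by
    rw [norm_pow]; exact pow_le_one₀ (norm_nonneg _) hz
  -- Adding the boundary term `b n * z ^ n` makes the induction telescope: each step subtracts only
  -- `(b n - b (n + 1)) * z ^ (n + 1)`.
  have key : ‖(1 - z) * ∑ k ∈ Finset.Ico m n, (b k : ℂ) * z ^ k + b n * z ^ n‖ ≤ 2 * b m - b n := by
    induction n, hn using Nat.le_induction with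
    | base =>
      have h0 := hb0 m le_rfl
      have : ‖(b m : ℂ) * z ^ m‖ ≤ b m := by
        rw [norm_mul, Complex.norm_real, Real.norm_of_nonneg h0]
        exact mul_le_of_le_one_right h0 (hpow m)
      simp only [Finset.Ico_self, Finset.sum_empty, mul_zero, zero_add]
      linarith
    | succ n hn ih =>
      rw [Finset.sum_Ico_succ_top hn]
      have e : (1 - z) * (∑ k ∈ Finset.Ico m n, (b k : ℂ) * z ^ k + b n * z ^ n) +
          b (n + 1) * z ^ (n + 1) =
          ((1 - z) * ∑ k ∈ Finset.Ico m n, (b k : ℂ) * z ^ k + b n * z ^ n) -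
          ((b n - b (n + 1) : ℝ) : ℂ) * z ^ (n + 1) := by
        push_cast; ring
      have h0 : 0 ≤ b n - b (n + 1) := sub_nonneg.2 (hb n hn)
      have h1 : ‖((b n - b (n + 1) : ℝ) : ℂ) * z ^ (n + 1)‖ ≤ b n - b (n + 1) := by
        rw [norm_mul, Complex.norm_real, Real.norm_of_nonneg h0]
        exact mul_le_of_le_one_right h0 (hpow _)
      rw [e]
      refine (norm_sub_le _ _).trans ?_
      linarith
  have h0 := hb0 n hn
  have h1 : ‖(b n : ℂ) * z ^ n‖ ≤ b n := by
    rw [norm_mul, Complex.norm_real, Real.norm_of_nonneg h0]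
    exact mul_le_of_le_one_right h0 (hpow n)
  have h2 := norm_sub_le ((1 - z) * ∑ k ∈ Finset.Ico m n, (b k : ℂ) * z ^ k + b n * z ^ n)
    (b n * z ^ n)
  rw [add_sub_cancel_right] at h2
  linarith

theorem norm_sum_rpow_tail_le {a : ℝ} (ha : 0 < a) {z : ℂ} (hz : ‖z‖ ≤ 1) {δ : ℝ} (hδ : 0 < δ)
    (hδz : δ ≤ ‖1 - z‖) {m n : ℕ} (hm : 0 < m) (hn : m ≤ n) :
    ‖∑ k ∈ Finset.Ico m n, (((k : ℝ) ^ (-a) : ℝ) : ℂ) * z ^ k‖ ≤ 2 * (m : ℝ) ^ (-a) / δ := by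
  have h := norm_one_sub_mul_sum_le (b := fun k : ℕ => (k : ℝ) ^ (-a)) (m := m)
    (fun k hk => Real.rpow_le_rpow_of_nonpos (by exact_mod_cast hm.trans_le hk)
      (by push_cast; linarith) (by linarith))
    (fun k _ => by positivity) hz hn
  rw [norm_mul] at h
  rw [le_div_iff₀ hδ, mul_comm]
  exact (mul_le_mul_of_nonneg_right hδz (norm_nonneg _)).trans h

/-- Discrete form of `∫₀^m x^{-a} dx`. The induction step is Bernoulli's inequality for `(1 -
1/(m+1))^{1-a}`. The term `k = 0` is harmless because `0 ^ (-a) = 0` by convention. -/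
theorem sum_rpow_neg_le {a : ℝ} (ha : 0 < a) (ha1 : a < 1) (m : ℕ) :
    ∑ k ∈ Finset.range (m + 1), (k : ℝ) ^ (-a) ≤ (m : ℝ) ^ (1 - a) / (1 - a) := by
  have h1a : 0 < 1 - a := by linarith
  induction m with
  | zero => simp [Real.zero_rpow (neg_ne_zero.2 ha.ne'), Real.zero_rpow h1a.ne']
  | succ m ih =>
    rw [Finset.sum_range_succ]
    have hm : (0 : ℝ) < (m : ℝ) + 1 := by positivity
    have hB := rpow_one_add_le_one_add_mul_self (s := -(1 / ((m : ℝ) + 1)))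
      (by rw [neg_le_neg_iff, div_le_one hm]; linarith [(Nat.cast_nonneg m : (0 : ℝ) ≤ m)])
      h1a.le (by linarith)
    have e1 : 1 + -(1 / ((m : ℝ) + 1)) = m / (m + 1) := by field_simp; ring
    rw [e1, Real.div_rpow (by positivity) hm.le, div_le_iff₀ (by positivity)] at hB
    have e2 : ((m : ℝ) + 1) ^ (1 - a) = (m + 1) * ((m : ℝ) + 1) ^ (-a) := by
      rw [sub_eq_add_neg, Real.rpow_add hm, Real.rpow_one]
    have e3 : (1 + (1 - a) * -(1 / ((m : ℝ) + 1))) * ((m : ℝ) + 1) ^ (1 - a) =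
        ((m : ℝ) + 1) ^ (1 - a) - (1 - a) * ((m : ℝ) + 1) ^ (-a) := by
      rw [e2]; field_simp; ring
    rw [e3] at hB
    push_cast
    rw [le_div_iff₀ h1a] at ih ⊢
    linarith

/-- Oscillation becomes effective at `k ~ 1/|ξ|`. Below that threshold absolute values are summed;
above it Abel summation gains `1/|1 - z| ≲ 1/|ξ|`. Both parts have order `|ξ|^{a-1}`, uniformly in
`n`. -/
theorem norm_sum_rpow_char_le {a : ℝ} (ha : 0 < a) (ha1 : a < 1) {ξ : ℝ} (hξ : |ξ| ≤ Real.pi)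
    (hξ0 : ξ ≠ 0) (n : ℕ) :
    ‖∑ k ∈ Finset.range n, (((k : ℝ) ^ (-a) : ℝ) : ℂ) * Complex.exp (-(Complex.I * (ξ : ℂ))) ^ k‖ ≤
      (5 / (1 - a) + 4) * |ξ| ^ (a - 1) := by
  set z := Complex.exp (-(Complex.I * (ξ : ℂ)))
  have hz : ‖z‖ = 1 := norm_exp_neg_I ξ
  have hx : 0 < |ξ| := abs_pos.2 hξ0
  have h1a : 0 < 1 - a := by linarith
  set m := ⌈1 / |ξ|⌉₊
  have hm1 : 1 / |ξ| ≤ m := Nat.le_ceil _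
  have hm2 : (m : ℝ) ≤ 5 / |ξ| := by
    have h1 : (m : ℝ) < 1 / |ξ| + 1 := Nat.ceil_lt_add_one (by positivity)
    -- The rounding error `1` is absorbed using `|ξ| ≤ π ≤ 4`.
    have h2 : 1 ≤ 4 / |ξ| := by
      rw [le_div_iff₀ hx]; linarith [Real.pi_le_four]
    have h3 : 5 / |ξ| = 1 / |ξ| + 4 / |ξ| := by ring
    linarith
  have hhead : ∀ s, s ⊆ Finset.range (m + 1) →
      ‖∑ k ∈ s, (((k : ℝ) ^ (-a) : ℝ) : ℂ) * z ^ k‖ ≤ 5 / (1 - a) * |ξ| ^ (a - 1) := by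
    intro s hs
    calc ‖∑ k ∈ s, (((k : ℝ) ^ (-a) : ℝ) : ℂ) * z ^ k‖
        ≤ ∑ k ∈ s, (k : ℝ) ^ (-a) := by
          refine norm_sum_le_of_le _ fun k _ => ?_
          rw [norm_mul, norm_pow, hz, one_pow, mul_one, Complex.norm_real,
            Real.norm_of_nonneg (by positivity)]
      _ ≤ ∑ k ∈ Finset.range (m + 1), (k : ℝ) ^ (-a) :=
          Finset.sum_le_sum_of_subset_of_nonneg hs fun _ _ _ => by positivity
      _ ≤ (m : ℝ) ^ (1 - a) / (1 - a) := sum_rpow_neg_le ha ha1 m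
      _ ≤ (5 / |ξ|) ^ (1 - a) / (1 - a) := by gcongr
      _ ≤ 5 / (1 - a) * |ξ| ^ (a - 1) := by
          rw [Real.div_rpow (by norm_num) hx.le, show a - 1 = -(1 - a) by ring,
            Real.rpow_neg hx.le]
          have : (5 : ℝ) ^ (1 - a) ≤ 5 := by
            simpa using Real.rpow_le_rpow_of_exponent_le (x := 5) (by norm_num)
              (show 1 - a ≤ 1 by linarith)
          rw [div_div, div_mul_eq_mul_div, div_mul_eq_div_div_swap, div_eq_mul_inv _ (1 - a),
            div_eq_mul_inv, div_eq_mul_inv _ (1 - a)]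
          have h0 : 0 ≤ (|ξ| ^ (1 - a))⁻¹ := by positivity
          have h00 : 0 ≤ (1 - a)⁻¹ := by positivity
          nlinarith [mul_le_mul_of_nonneg_right this (mul_nonneg h0 h00)]
  have hp : 0 ≤ |ξ| ^ (a - 1) := by positivity
  rcases le_total n (m + 1) with hn | hn
  · refine (hhead _ (Finset.range_subset_range.2 hn)).trans ?_
    gcongr; linarith
  · rw [← Finset.sum_range_add_sum_Ico _ hn]
    refine (norm_add_le _ _).trans ?_
    have ht := norm_sum_rpow_tail_le ha hz.le (half_pos hx)
      (half_abs_le_norm_one_sub_exp hξ) (Nat.succ_pos m) hn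
    have h1 : ((m + 1 : ℕ) : ℝ) ^ (-a) ≤ (1 / |ξ|) ^ (-a) :=
      Real.rpow_le_rpow_of_nonpos (by positivity) (by push_cast; linarith) (by linarith)
    have h2 : (1 / |ξ|) ^ (-a) = |ξ| ^ a := by
      rw [one_div, Real.inv_rpow hx.le, Real.rpow_neg hx.le, inv_inv]
    have h3 : |ξ| ^ (a - 1) = |ξ| ^ a / |ξ| := by rw [Real.rpow_sub hx, Real.rpow_one]
    have h4 : 2 * ((m + 1 : ℕ) : ℝ) ^ (-a) / (|ξ| / 2) ≤ 4 * |ξ| ^ (a - 1) := by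
      rw [h2] at h1
      rw [h3]
      have : 2 * ((m + 1 : ℕ) : ℝ) ^ (-a) / (|ξ| / 2) ≤ 2 * |ξ| ^ a / (|ξ| / 2) := by gcongr
      refine this.trans (le_of_eq ?_)
      field_simp; norm_num
    rw [add_mul]
    exact add_le_add (hhead _ subset_rfl) (ht.trans h4)

theorem summable_rpow_norm {a : ℝ} (ha : 0 < a) :
    Summable fun k : ℕ => ‖(((k : ℝ) ^ (-1 - a) : ℝ) : ℂ)‖ := by
  have : Summable fun k : ℕ => (k : ℝ) ^ (-1 - a) := Real.summable_nat_rpow.2 (by linarith)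
  simpa [Complex.norm_real] using this.norm

open Filter Topology in
/-- The series `∑ k^{-1-a} e^{-ikξ}` is differentiable away from `0`, with derivative
`O(|ξ|^{a-1})`. -/
theorem exists_hasDerivAt_fourierC_rpow {a : ℝ} (ha : 0 < a) (ha1 : a < 1) {ξ : ℝ}
    (hξ : |ξ| ≤ Real.pi) (hξ0 : ξ ≠ 0) :
    ∃ d, HasDerivAt (fourierC fun k => (((k : ℝ) ^ (-1 - a) : ℝ) : ℂ)) d ξ ∧
      ‖d‖ ≤ (5 / (1 - a) + 4) * |ξ| ^ (a - 1) := by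
  have hcont : Continuous fun x : ℝ => ‖1 - Complex.exp (-(Complex.I * (x : ℂ)))‖ := by fun_prop
  -- Since `|1 - e^{-iξ}| ≥ |ξ|/2`, the strict bound by `|ξ|/4` holds on an open neighbourhood of
  -- `ξ`, where the tail estimates are uniform.
  set δ := |ξ| / 4 with hδdef
  have hδ : 0 < δ := by have := abs_pos.2 hξ0; positivity
  set s := {x : ℝ | δ < ‖1 - Complex.exp (-(Complex.I * (x : ℂ)))‖}
  have hs : IsOpen s := isOpen_lt continuous_const hcont
  have hξs : ξ ∈ s := by
    have := half_abs_le_norm_one_sub_exp hξ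
    change δ < _
    have := abs_pos.2 hξ0
    linarith
  let S : ℕ → ℝ → ℂ := fun n x => ∑ k ∈ Finset.range n,
    (((k : ℝ) ^ (-1 - a) : ℝ) : ℂ) * Complex.exp (-(Complex.I * (k : ℂ) * (x : ℂ)))
  let T : ℕ → ℝ → ℂ := fun n x => ∑ k ∈ Finset.range n,
    (((k : ℝ) ^ (-a) : ℝ) : ℂ) * Complex.exp (-(Complex.I * (x : ℂ))) ^ k
  have hST : ∀ n x, HasDerivAt (S n) (-Complex.I * T n x) x := by
    intro n x
    refine (HasDerivAt.fun_sum fun k _ => (hasDerivAt_char k x).const_mul _).congr_deriv ?_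
    simp only [T, Finset.mul_sum]
    refine Finset.sum_congr rfl fun k _ => ?_
    rw [← char_eq_pow]
    have : (k : ℝ) ^ (-a) = k * (k : ℝ) ^ (-1 - a) := by
      rcases Nat.eq_zero_or_pos k with rfl | hk
      · simp [Real.zero_rpow (neg_ne_zero.2 ha.ne')]
      · have hk' : (0 : ℝ) < k := by exact_mod_cast hk
        rw [show -a = 1 + (-1 - a) by ring, Real.rpow_add hk', Real.rpow_one]
    rw [this]; push_cast; ring
  have hlim0 : Tendsto (fun n : ℕ => 2 * (n : ℝ) ^ (-a) / δ) atTop (𝓝 0) := by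
    have := (tendsto_rpow_neg_atTop ha).comp (tendsto_natCast_atTop_atTop (R := ℝ))
    simpa using (this.const_mul 2).div_const δ
  have hdiff : ∀ m n x, 0 < m → m ≤ n → x ∈ s → dist (T m x) (T n x) ≤ 2 * (m : ℝ) ^ (-a) / δ := by
    intro m n x hm hn hx
    rw [dist_comm, dist_eq_norm, ← Finset.sum_Ico_eq_sub _ hn]
    exact norm_sum_rpow_tail_le ha (norm_exp_neg_I x).le hδ (le_of_lt hx) hm hn
  have hcau : UniformCauchySeqOn T atTop s := by
    rw [Metric.uniformCauchySeqOn_iff]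
    intro ε hε
    obtain ⟨N, hN⟩ := eventually_atTop.1 (hlim0.eventually_lt_const hε)
    refine ⟨N + 1, fun m hm n hn x hx => ?_⟩
    rcases le_total m n with h | h
    · exact (hdiff m n x (by omega) h hx).trans_lt (hN m (by omega))
    · rw [dist_comm]
      exact (hdiff n m x (by omega) h hx).trans_lt (hN n (by omega))
  let G : ℝ → ℂ := fun x => limUnder atTop fun n => T n x
  have hG : ∀ x ∈ s, Tendsto (fun n => T n x) atTop (𝓝 (G x)) := fun x hx =>
    tendsto_nhds_limUnder (cauchySeq_tendsto_of_complete (hcau.cauchySeq hx))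
  have hunif : TendstoUniformlyOn (fun n x => -Complex.I * T n x) (fun x => -Complex.I * G x)
      atTop s :=
    (uniformContinuous_const_smul (-Complex.I)).comp_tendstoUniformlyOn
      (hcau.tendstoUniformlyOn_of_tendsto hG)
  refine ⟨-Complex.I * G ξ, ?_, ?_⟩
  · exact hasDerivAt_of_tendstoUniformlyOn hs hunif (Eventually.of_forall fun n x _ => hST n x)
      (fun x _ => (summable_fourierC (summable_rpow_norm ha) x).hasSum.tendsto_sum_nat) hξs
  · rw [norm_mul, norm_neg, Complex.norm_I, one_mul]
    exact le_of_tendsto (hG ξ hξs).norm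
      (Eventually.of_forall fun n => norm_sum_rpow_char_le ha ha1 hξ hξ0 n)

/-! ### Consecutive points of the support and aperiodicity. -/

/-- A function which is bounded below by `k^{-1-a}`, up to an error with finite first moment, does
not vanish at two consecutive integers. -/
theorem exists_consecutive_ne_zero {F Q : ℕ → ℝ} {a c : ℝ} (ha : 0 < a) (ha1 : a < 1) (hc : 0 < c)
    (hQ : Summable fun k : ℕ => (k : ℝ) * |Q k|)
    (hlow : ∀ k : ℕ, c * (k : ℝ) ^ (-1 - a) ≤ F k + |Q k|) :
    ∃ k, F k ≠ 0 ∧ F (k + 1) ≠ 0 := by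
  by_contra! hcon
  have hz : ∀ k : ℕ, 0 < k → F k = 0 → c * (k : ℝ) ^ (-a) ≤ k * |Q k| := by
    intro k hk h0
    have hk' : (0 : ℝ) < k := by exact_mod_cast hk
    have h := hlow k
    rw [h0, zero_add] at h
    have : (k : ℝ) ^ (-a) = k * (k : ℝ) ^ (-1 - a) := by
      rw [show -a = 1 + (-1 - a) by ring, Real.rpow_add hk', Real.rpow_one]
    rw [this]
    calc c * ((k : ℝ) * (k : ℝ) ^ (-1 - a)) = k * (c * (k : ℝ) ^ (-1 - a)) := by ring
      _ ≤ k * |Q k| := by gcongr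
  have hQ1 : Summable fun k : ℕ => ((k + 1 : ℕ) : ℝ) * |Q (k + 1)| :=
    (summable_nat_add_iff 1).2 hQ
  have hQ2 : Summable fun k : ℕ => ((k + 2 : ℕ) : ℝ) * |Q (k + 2)| :=
    (summable_nat_add_iff 2).2 hQ
  have hs : Summable fun k : ℕ => c * ((k + 2 : ℕ) : ℝ) ^ (-a) := by
    -- Of `k + 1` and `k + 2` at least one is a zero of `F`, and there `k|Q k|` must compensate the
    -- missing power; this would make the divergent series `∑ k^{-a}` converge.
    refine Summable.of_nonneg_of_le (fun k => by positivity) (fun k => ?_) (hQ1.add hQ2)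
    by_cases h : F (k + 1) = 0
    · have h1 := hz (k + 1) (by omega) h
      have h2 : ((k + 2 : ℕ) : ℝ) ^ (-a) ≤ ((k + 1 : ℕ) : ℝ) ^ (-a) :=
        Real.rpow_le_rpow_of_nonpos (by positivity) (by push_cast; linarith) (by linarith)
      have h3 : 0 ≤ ((k + 2 : ℕ) : ℝ) * |Q (k + 2)| := by positivity
      have := mul_le_mul_of_nonneg_left h2 hc.le
      linarith
    · have h1 := hz (k + 2) (by omega) (hcon _ h)
      have h3 : 0 ≤ ((k + 1 : ℕ) : ℝ) * |Q (k + 1)| := by positivity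
      linarith
  have hs2 : Summable fun k : ℕ => (k : ℝ) ^ (-a) :=
    (summable_nat_add_iff 2).1 ((summable_mul_left_iff hc.ne').1 hs)
  have := Real.summable_nat_rpow.1 hs2
  linarith

/-- The difference of the two translated support points is `1`, whatever the translation. -/
theorem isAperiodic_of_consecutive {F : ℕ → ℝ} (h : ∃ k, F k ≠ 0 ∧ F (k + 1) ≠ 0) :
    IsAperiodic F := by
  obtain ⟨k, h0, h1⟩ := h
  intro m
  have h2 := AddSubgroup.subset_closure (show m + (k : ℤ) ∈ translateSupport F m from ⟨k, h0, rfl⟩)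
  have h3 := AddSubgroup.subset_closure
    (show m + ((k + 1 : ℕ) : ℤ) ∈ translateSupport F m from ⟨k + 1, h1, rfl⟩)
  have h4 := sub_mem h3 h2
  rw [show m + ((k + 1 : ℕ) : ℤ) - (m + (k : ℤ)) = 1 by push_cast; ring] at h4
  rw [AddSubgroup.eq_top_iff']
  intro x
  simpa using zsmul_mem h4 x

/-! ### Lower bound for the real part of `1 - F̂` near the origin. -/

theorem summable_mul_one_sub_cos {f : ℕ → ℝ} (hf : Summable fun k => |f k|) (ξ : ℝ) :
    Summable fun k : ℕ => f k * (1 - Real.cos (k * ξ)) := by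
  refine Summable.of_norm_bounded (hf.mul_left 2) fun k => ?_
  rw [norm_mul, Real.norm_eq_abs, Real.norm_eq_abs, mul_comm]
  gcongr
  rw [abs_le]
  constructor <;> linarith [Real.neg_one_le_cos (k * ξ), Real.cos_le_one (k * ξ)]

theorem one_sub_re_fourierZ {F : ℕ → ℝ} (hF : IsProbability F) (ξ : ℝ) :
    1 - (fourierZ F ξ).re = ∑' k : ℕ, F k * (1 - Real.cos (k * ξ)) := by
  have hs : Summable fun k => ‖(F k : ℂ)‖ := by
    simpa [Complex.norm_real] using hF.hasSum.summable.norm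
  have h := (Complex.hasSum_re (summable_fourierC hs ξ).hasSum)
  have h2 := hF.hasSum.sub h
  rw [fourierZ_eq, fourierC, ← h2.tsum_eq]
  refine tsum_congr fun k => ?_
  rw [Complex.re_ofReal_mul, char_re]
  ring

/-- All terms are nonnegative, so one block `m ≤ k < 2m` with `m ~ 1/|ξ|` suffices. There `k|ξ|`
lies in `[1, 3]`, hence `1 - cos ≥ 4/9`. The `m` terms add up to at least `(2/9)(2m)^{-a}`, and `2m
≤ 4/|ξ|`. -/
theorem rpow_div_le_tsum_one_sub_cos {a : ℝ} (ha : 0 < a) (ha1 : a < 1) {ξ : ℝ} (hξ0 : ξ ≠ 0)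
    (hξ : |ξ| ≤ 1 / 2) :
    |ξ| ^ a / 18 ≤ ∑' k : ℕ, (k : ℝ) ^ (-1 - a) * (1 - Real.cos (k * ξ)) := by
  have hx : 0 < |ξ| := abs_pos.2 hξ0
  have hsum : Summable fun k : ℕ => |(k : ℝ) ^ (-1 - a)| :=
    (Real.summable_nat_rpow.2 (by linarith : -1 - a < -1)).abs
  set m := ⌈1 / |ξ|⌉₊
  have hm1 : 1 / |ξ| ≤ m := Nat.le_ceil _
  have hm2 : (m : ℝ) < 1 / |ξ| + 1 := Nat.ceil_lt_add_one (by positivity)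
  have hm0 : (0 : ℝ) < m := lt_of_lt_of_le (by positivity) hm1
  have hm0' : 0 < m := by exact_mod_cast hm0
  have hm3 : 1 ≤ m * |ξ| := by rwa [div_le_iff₀ hx] at hm1
  have hm4 : m * |ξ| ≤ 3 / 2 := by
    have := mul_le_mul_of_nonneg_right hm2.le hx.le
    rw [add_mul, one_div, inv_mul_cancel₀ hx.ne'] at this
    linarith
  have hnn : ∀ k : ℕ, 0 ≤ (k : ℝ) ^ (-1 - a) * (1 - Real.cos (k * ξ)) := fun k =>
    mul_nonneg (by positivity) (by linarith [Real.cos_le_one (k * ξ)])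
  refine le_trans ?_ ((summable_mul_one_sub_cos hsum ξ).sum_le_tsum (Finset.Ico m (2 * m))
    fun k _ => hnn k)
  have hterm : ∀ k ∈ Finset.Ico m (2 * m),
      (2 * m : ℝ) ^ (-1 - a) * (4 / 9) ≤ (k : ℝ) ^ (-1 - a) * (1 - Real.cos (k * ξ)) := by
    intro k hk
    rw [Finset.mem_Ico] at hk
    have hk1 : (m : ℝ) ≤ k := by exact_mod_cast hk.1
    have hk2 : (k : ℝ) ≤ 2 * m := by exact_mod_cast hk.2.le
    have hcos : Real.cos (k * ξ) ≤ 5 / 9 := by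
      rw [← Real.cos_abs, abs_mul, Nat.abs_cast]
      refine le_trans (Real.cos_le_cos_of_nonneg_of_le_pi zero_le_one ?_ ?_) Real.cos_one_le
      · have : (k : ℝ) * |ξ| ≤ 2 * m * |ξ| := by gcongr
        linarith [Real.pi_gt_three]
      · have : (m : ℝ) * |ξ| ≤ k * |ξ| := by gcongr
        linarith
    have h1 : (2 * m : ℝ) ^ (-1 - a) ≤ (k : ℝ) ^ (-1 - a) :=
      Real.rpow_le_rpow_of_nonpos (hm0.trans_le hk1) hk2 (by linarith)
    exact mul_le_mul h1 (by linarith) (by norm_num) (by positivity)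
  have hcard := Finset.card_nsmul_le_sum _ _ _ hterm
  rw [Nat.card_Ico, nsmul_eq_mul, show 2 * m - m = m by omega] at hcard
  refine le_trans ?_ hcard
  have e1 : (2 * m : ℝ) ^ (-1 - a) = (2 * m : ℝ)⁻¹ * (2 * m : ℝ) ^ (-a) := by
    rw [sub_eq_add_neg, Real.rpow_add (by positivity), Real.rpow_neg_one]
  have e2 : (m : ℝ) * ((2 * m : ℝ) ^ (-1 - a) * (4 / 9)) = 2 / 9 * (2 * m : ℝ) ^ (-a) := by
    rw [e1]; field_simp; norm_num
  have h3 : (4 / |ξ|) ^ (-a) ≤ (2 * m : ℝ) ^ (-a) := by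
    refine Real.rpow_le_rpow_of_nonpos (by positivity) ?_ (by linarith)
    rw [le_div_iff₀ hx]; linarith
  have h4 : (4 / |ξ|) ^ (-a) = (4 : ℝ) ^ (-a) * |ξ| ^ a := by
    rw [Real.div_rpow (by norm_num) hx.le, Real.rpow_neg hx.le, div_inv_eq_mul]
  have h5 : (1 : ℝ) / 4 ≤ (4 : ℝ) ^ (-a) := by
    have := Real.rpow_le_rpow_of_exponent_le (x := 4) (by norm_num) (show -1 ≤ -a by linarith)
    rwa [Real.rpow_neg_one, ← one_div] at this
  have h6 : 0 ≤ |ξ| ^ a := by positivity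
  rw [e2]
  nlinarith [mul_le_mul_of_nonneg_right h5 h6]

theorem one_sub_cos_le_abs (x : ℝ) : 1 - Real.cos x ≤ |x| := by
  rcases le_total |x| 2 with h | h
  · have := Real.one_sub_sq_div_two_le_cos (x := x)
    have h2 : x ^ 2 = |x| * |x| := by rw [← sq, sq_abs]
    nlinarith [abs_nonneg x]
  · linarith [Real.neg_one_le_cos x]

/-- The lower bound `1 - Re F̂(ξ) ≥ ε |ξ|^a` near `0`. -/
theorem exists_le_one_sub_re_fourierZ {F Q : ℕ → ℝ} (hF : IsProbability F) {a c : ℝ} (ha : 0 < a)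
    (ha1 : a < 1) (hc : 0 < c) (hQ0 : Summable fun k : ℕ => |Q k|)
    (hQ : Summable fun k : ℕ => (k : ℝ) * |Q k|)
    (hlow : ∀ k : ℕ, c * (k : ℝ) ^ (-1 - a) ≤ F k + |Q k|) :
    ∃ ε : ℝ, 0 < ε ∧ ε < 1 ∧ ∀ ξ ∈ Set.Icc (-ε) ε, ε * |ξ| ^ a ≤ 1 - (fourierZ F ξ).re := by
  set B := ∑' k : ℕ, (k : ℝ) * |Q k|
  have hB : 0 ≤ B := tsum_nonneg fun k => by positivity
  have h1a : 0 < 1 - a := by linarith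
  -- For `|ξ| ≤ t` the error `B|ξ|` is at most `(c/36)|ξ|^a`, half of the main term `(c/18)|ξ|^a`.
  -- This is where `a < 1` enters.
  set t := (c / (36 * (B + 1))) ^ (1 / (1 - a))
  have ht : 0 < t := by positivity
  refine ⟨min (1 / 2) (min (c / 36) t), by positivity,
    (min_le_left _ _).trans_lt (by norm_num), fun ξ hξ => ?_⟩
  set ε := min (1 / 2 : ℝ) (min (c / 36) t) with hε
  have hξ' : |ξ| ≤ ε := abs_le.2 hξ
  rcases eq_or_ne ξ 0 with rfl | hξ0
  · rw [one_sub_re_fourierZ hF]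
    simp [Real.zero_rpow ha.ne']
  have hx : 0 < |ξ| := abs_pos.2 hξ0
  have h1 := rpow_div_le_tsum_one_sub_cos ha ha1 hξ0 (hξ'.trans (min_le_left _ _))
  have hFa : Summable fun k => |F k| := hF.hasSum.summable.abs
  have hwa : Summable fun k : ℕ => |(k : ℝ) ^ (-1 - a)| :=
    (Real.summable_nat_rpow.2 (by linarith : -1 - a < -1)).abs
  have hQa : Summable fun k : ℕ => |(|Q k|)| := by simpa using hQ0
  have h2 : c * ∑' k : ℕ, (k : ℝ) ^ (-1 - a) * (1 - Real.cos (k * ξ)) ≤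
      (∑' k : ℕ, F k * (1 - Real.cos (k * ξ))) + ∑' k : ℕ, |Q k| * (1 - Real.cos (k * ξ)) := by
    rw [← tsum_mul_left, ← (summable_mul_one_sub_cos hFa ξ).tsum_add
      (summable_mul_one_sub_cos hQa ξ)]
    refine ((summable_mul_one_sub_cos hwa ξ).mul_left c).tsum_le_tsum (fun k => ?_)
      ((summable_mul_one_sub_cos hFa ξ).add (summable_mul_one_sub_cos hQa ξ))
    rw [← mul_assoc, ← add_mul]
    exact mul_le_mul_of_nonneg_right (hlow k) (by linarith [Real.cos_le_one (k * ξ)])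
  have h3 : ∑' k : ℕ, |Q k| * (1 - Real.cos (k * ξ)) ≤ B * |ξ| := by
    rw [← tsum_mul_right]
    refine (summable_mul_one_sub_cos hQa ξ).tsum_le_tsum (fun k => ?_) (hQ.mul_right _)
    have := one_sub_cos_le_abs (k * ξ)
    rw [abs_mul, Nat.abs_cast] at this
    calc |Q k| * (1 - Real.cos (k * ξ)) ≤ |Q k| * (k * |ξ|) := by gcongr
      _ = k * |Q k| * |ξ| := by ring
  have h4 : B * |ξ| ≤ c / 36 * |ξ| ^ a := by
    have e : |ξ| = |ξ| ^ (1 - a) * |ξ| ^ a := by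
      rw [← Real.rpow_add hx, sub_add_cancel, Real.rpow_one]
    have h5 : |ξ| ^ (1 - a) ≤ c / (36 * (B + 1)) := by
      have h6 : |ξ| ≤ t := hξ'.trans ((min_le_right _ _).trans (min_le_right _ _))
      have := Real.rpow_le_rpow hx.le h6 h1a.le
      rwa [← Real.rpow_mul (by positivity), one_div, inv_mul_cancel₀ h1a.ne', Real.rpow_one] at this
    have h7 : B * |ξ| ^ (1 - a) ≤ c / 36 := by
      calc B * |ξ| ^ (1 - a) ≤ (B + 1) * (c / (36 * (B + 1))) := by
            gcongr; linarith
        _ = c / 36 := by field_simp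
    calc B * |ξ| = B * |ξ| ^ (1 - a) * |ξ| ^ a := by rw [mul_assoc, ← e]
      _ ≤ c / 36 * |ξ| ^ a := by gcongr
  have h8 : ε * |ξ| ^ a ≤ c / 36 * |ξ| ^ a := by
    gcongr
    exact (min_le_right _ _).trans (min_le_left _ _)
  rw [one_sub_re_fourierZ hF]
  have h9 := mul_le_mul_of_nonneg_left h1 hc.le
  linarith

/-! ### Derivative bound for `F̂`. -/

theorem rpow_sub_one_le_pi_mul {a b x : ℝ} (hx : 0 < x) (hxp : x ≤ Real.pi) (hab : a ≤ b)
    (hb : b - a ≤ 1) : x ^ (b - 1) ≤ Real.pi * x ^ (a - 1) := by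
  have h1 : x ^ (b - 1) = x ^ (b - a) * x ^ (a - 1) := by
    rw [← Real.rpow_add hx]; congr 1; ring
  rw [h1]
  gcongr
  calc x ^ (b - a) ≤ Real.pi ^ (b - a) := Real.rpow_le_rpow hx.le hxp (by linarith)
    _ ≤ Real.pi ^ (1 : ℝ) :=
        Real.rpow_le_rpow_of_exponent_le (by linarith [Real.pi_gt_three]) hb
    _ = Real.pi := Real.rpow_one _

/-- The derivative of the Fourier series of a positive combination of powers `k^{-1-α_j}`, up to
an error with finite first moment. -/
theorem exists_deriv_fourierZ_bound {ι : Type*} [Fintype ι] {F Q : ℕ → ℝ} {α c : ι → ℝ} {a : ℝ}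
    (ha : 0 < a) (ha1 : a ≤ 1) (haα : ∀ j, a ≤ α j) (hα1 : ∀ j, α j < 1)
    (hQ0 : Summable fun k : ℕ => |Q k|) (hQ : Summable fun k : ℕ => (k : ℝ) * |Q k|)
    (hFQ : ∀ k : ℕ, F k = (∑ j, c j * (k : ℝ) ^ (-1 - α j)) + Q k) :
    ∃ C : ℝ, 0 < C ∧ ∀ ξ : ℝ, |ξ| ≤ Real.pi → ξ ≠ 0 →
      DifferentiableAt ℝ (fourierZ F) ξ ∧ ‖deriv (fourierZ F) ξ‖ ≤ C * |ξ| ^ (a - 1) := by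
  have hα : ∀ j, 0 < α j := fun j => ha.trans_le (haα j)
  have hQ0' : Summable fun k => ‖(Q k : ℂ)‖ := by simpa [Complex.norm_real] using hQ0
  have hQ' : Summable fun k : ℕ => (k : ℝ) * ‖(Q k : ℂ)‖ := by
    simpa [Complex.norm_real] using hQ
  have hdec : fourierZ F = fun ξ => (∑ j, (c j : ℂ) *
      fourierC (fun k => (((k : ℝ) ^ (-1 - α j) : ℝ) : ℂ)) ξ) + fourierC (fun k => (Q k : ℂ)) ξ := by
    funext ξ
    have h1 : HasSum (fun k : ℕ => (∑ j, (c j : ℂ) * ((((k : ℝ) ^ (-1 - α j) : ℝ) : ℂ) *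
        Complex.exp (-(Complex.I * (k : ℂ) * (ξ : ℂ))))) +
        (Q k : ℂ) * Complex.exp (-(Complex.I * (k : ℂ) * (ξ : ℂ)))) _ :=
      (hasSum_sum fun j _ =>
        (summable_fourierC (summable_rpow_norm (hα j)) ξ).hasSum.mul_left (c j : ℂ)).add
        (summable_fourierC hQ0' ξ).hasSum
    rw [fourierZ]
    refine Eq.trans (tsum_congr fun k => ?_) h1.tsum_eq
    rw [hFQ k]
    push_cast
    rw [add_mul, Finset.sum_mul]
    simp only [mul_assoc]
  set B := ∑' k : ℕ, (k : ℝ) * |Q k|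
  have hB : 0 ≤ B := tsum_nonneg fun k => by positivity
  have hCj : ∀ j, 0 ≤ |c j| * (5 / (1 - α j) + 4) := fun j => by
    have : 0 < 1 - α j := by linarith [hα1 j]
    positivity
  refine ⟨Real.pi * ((∑ j, |c j| * (5 / (1 - α j) + 4)) + B + 1), ?_, fun ξ hξ hξ0 => ?_⟩
  · have := Finset.sum_nonneg fun j (_ : j ∈ Finset.univ) => hCj j
    have := Real.pi_pos
    positivity
  have hx : 0 < |ξ| := abs_pos.2 hξ0
  choose d hd hdn using fun j => exists_hasDerivAt_fourierC_rpow (hα j) (hα1 j) hξ hξ0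
  have hder : HasDerivAt (fourierZ F)
      ((∑ j, (c j : ℂ) * d j) + fourierC (fun k => -(Complex.I * k) * (Q k : ℂ)) ξ) ξ := by
    rw [hdec]
    exact (HasDerivAt.fun_sum fun j _ => (hd j).const_mul (c j : ℂ)).add
      (hasDerivAt_fourierC hQ0' hQ' ξ)
  refine ⟨hder.differentiableAt, ?_⟩
  rw [hder.deriv]
  have hp : 0 ≤ |ξ| ^ (a - 1) := by positivity
  have h1 : ‖fourierC (fun k => -(Complex.I * k) * (Q k : ℂ)) ξ‖ ≤ B := by
    have := norm_fourierC_le (f := fun k => -(Complex.I * k) * (Q k : ℂ))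
      (by simpa [Complex.norm_real] using hQ) ξ
    simpa [Complex.norm_real] using this
  have h2 : B ≤ Real.pi * B * |ξ| ^ (a - 1) := by
    -- The exponent `b = 1` turns the constant bound for the remainder into a multiple of
    -- `|ξ|^{a-1}`.
    have := rpow_sub_one_le_pi_mul (a := a) (b := 1) hx hξ ha1 (by linarith)
    rw [sub_self, Real.rpow_zero] at this
    nlinarith
  have h3 : ‖∑ j, (c j : ℂ) * d j‖ ≤
      Real.pi * (∑ j, |c j| * (5 / (1 - α j) + 4)) * |ξ| ^ (a - 1) := by
    rw [Finset.mul_sum, Finset.sum_mul]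
    refine norm_sum_le_of_le _ fun j _ => ?_
    rw [norm_mul, Complex.norm_real, Real.norm_eq_abs]
    have h4 := rpow_sub_one_le_pi_mul hx hξ (haα j) (by linarith [hα1 j])
    have h5 : 0 < 1 - α j := by linarith [hα1 j]
    calc |c j| * ‖d j‖ ≤ |c j| * ((5 / (1 - α j) + 4) * |ξ| ^ (α j - 1)) := by gcongr; exact hdn j
      _ ≤ |c j| * ((5 / (1 - α j) + 4) * (Real.pi * |ξ| ^ (a - 1))) := by gcongr
      _ = _ := by ring
  refine (norm_add_le _ _).trans ?_
  have := mul_nonneg Real.pi_pos.le hp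
  linarith

/-! ### Hölder bound at the origin and exponential decay of `F̂`. -/

theorem rpow_mul_exp_neg_le {p c u : ℝ} (hp : 0 < p) (hc : 0 < c) (hu : 0 ≤ u) :
    u ^ p * Real.exp (-(c * u)) ≤ (p / c) ^ p := by
  have h1 : c * u / p ≤ Real.exp (c * u / p) := by
    linarith [Real.add_one_le_exp (c * u / p)]
  have h2 := Real.rpow_le_rpow (by positivity) h1 hp.le
  rw [← Real.exp_mul, div_mul_cancel₀ _ hp.ne'] at h2
  have h3 : u ^ p = (p / c) ^ p * (c * u / p) ^ p := by
    rw [← Real.mul_rpow (by positivity) (by positivity)]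
    congr 1; field_simp
  rw [h3, Real.exp_neg, mul_assoc]
  refine mul_le_of_le_one_right (by positivity) ?_
  rw [← div_eq_mul_inv]
  exact (div_le_one (Real.exp_pos _)).2 h2

/-- The primitive `(c/a) x^a` of the bound dominates the increment on `[δ, ξ]`. The derivative bound
is not available at `0`, so `δ > 0` is kept until continuity allows `δ → 0`. -/
theorem norm_sub_le_of_deriv_le_rpow_aux {f : ℝ → ℂ} (hf : Continuous f) {a c R : ℝ} (ha : 0 < a)
    (hd : ∀ t, 0 < t → t ≤ R → ∃ d, HasDerivAt f d t ∧ ‖d‖ ≤ c * t ^ (a - 1))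
    {ξ : ℝ} (hξ0 : 0 < ξ) (hξ : ξ ≤ R) : ‖f ξ - f 0‖ ≤ c / a * ξ ^ a := by
  have hc : 0 ≤ c := by
    obtain ⟨d, -, hdn⟩ := hd ξ hξ0 hξ
    by_contra h
    have : 0 < ξ ^ (a - 1) := by positivity
    nlinarith [norm_nonneg d]
  have key : ∀ δ ∈ Set.Ioo 0 ξ, ‖f ξ - f δ‖ ≤ c / a * ξ ^ a := by
    intro δ hδ
    have hB : ∀ x, 0 < x → HasDerivAt (fun x : ℝ => c / a * (x ^ a - δ ^ a))
        (c * x ^ (a - 1)) x := by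
      intro x hx
      have := ((Real.hasDerivAt_rpow_const (p := a) (Or.inl hx.ne')).sub_const (δ ^ a)).const_mul
        (c / a)
      refine this.congr_deriv ?_
      field_simp
    have h := image_norm_le_of_norm_deriv_right_le_deriv_boundary'
      (f := fun x => f x - f δ) (f' := deriv f) (a := δ) (b := ξ)
      (B := fun x => c / a * (x ^ a - δ ^ a)) (B' := fun x => c * x ^ (a - 1))
      (by fun_prop)
      (fun x hx => by
        obtain ⟨d, hdx, -⟩ := hd x (hδ.1.trans_le hx.1) (hx.2.le.trans hξ)
        exact (hdx.differentiableAt.hasDerivAt.sub_const _).hasDerivWithinAt)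
      (by simp)
      (fun x hx => (hB x (hδ.1.trans_le hx.1)).continuousAt.continuousWithinAt)
      (fun x hx => (hB x (hδ.1.trans_le hx.1)).hasDerivWithinAt)
      (fun x hx => by
        obtain ⟨d, hdx, hdn⟩ := hd x (hδ.1.trans_le hx.1) (hx.2.le.trans hξ)
        rwa [hdx.deriv])
    refine (h (Set.right_mem_Icc.2 hδ.2.le)).trans ?_
    gcongr
    linarith [Real.rpow_nonneg hδ.1.le a]
  have hlim : Filter.Tendsto (fun δ => ‖f ξ - f δ‖) (nhdsWithin 0 (Set.Ioi 0))
      (nhds ‖f ξ - f 0‖) := by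
    have : Continuous fun δ => ‖f ξ - f δ‖ := by fun_prop
    exact (this.tendsto 0).mono_left nhdsWithin_le_nhds
  exact le_of_tendsto hlim (Filter.mem_of_superset (Ioo_mem_nhdsGT hξ0) key)

/-- A function whose derivative is `O(|t|^{a-1})` is `a`-Hölder at the origin. -/
theorem norm_sub_le_of_deriv_le_rpow {f : ℝ → ℂ} (hf : Continuous f) {a c R : ℝ} (ha : 0 < a)
    (hd : ∀ t, t ≠ 0 → |t| ≤ R → ∃ d, HasDerivAt f d t ∧ ‖d‖ ≤ c * |t| ^ (a - 1))
    {ξ : ℝ} (hξ : |ξ| ≤ R) : ‖f ξ - f 0‖ ≤ c / a * |ξ| ^ a := by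
  rcases lt_trichotomy ξ 0 with h | rfl | h
  · have hneg := norm_sub_le_of_deriv_le_rpow_aux (f := fun x => f (-x)) (by fun_prop) ha
      (c := c) (R := R) (ξ := -ξ) (fun t ht htR => by
        obtain ⟨d, hdt, hdn⟩ := hd (-t) (by linarith) (by rwa [abs_neg, abs_of_pos ht])
        rw [abs_neg, abs_of_pos ht] at hdn
        refine ⟨-d, ?_, by rwa [norm_neg]⟩
        exact (hdt.scomp t (hasDerivAt_neg t)).congr_deriv (by simp)) (by linarith) (by rwa [abs_of_neg h] at hξ)
    simpa [abs_of_neg h] using hneg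
  · simp [Real.zero_rpow ha.ne']
  · rw [abs_of_pos h] at hξ ⊢
    refine norm_sub_le_of_deriv_le_rpow_aux hf ha (fun t ht htR => ?_) h hξ
    simpa [abs_of_pos ht] using hd t ht.ne' (by rwa [abs_of_pos ht])

/-- Equality case of the triangle inequality: if `|F̂(ξ)| = 1`, all the phases `z ^ j` with `F j ≠
0` coincide, and two consecutive ones force `z = 1`. -/
theorem norm_fourierZ_lt_one {F : ℕ → ℝ} (hF : IsProbability F)
    (h : ∃ k, F k ≠ 0 ∧ F (k + 1) ≠ 0) {ξ : ℝ} (hξ : |ξ| ≤ Real.pi) (hξ0 : ξ ≠ 0) :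
    ‖fourierZ F ξ‖ < 1 := by
  obtain ⟨k, hk0, hk1⟩ := h
  by_contra! hcon
  have hs : Summable fun k => ‖(F k : ℂ)‖ := by
    simpa [Complex.norm_real] using hF.hasSum.summable.norm
  set z := Complex.exp (-(Complex.I * (ξ : ℂ)))
  have hz : ‖z‖ = 1 := norm_exp_neg_I ξ
  set v := fourierZ F ξ with hv
  have hv0 : (‖v‖ : ℂ) ≠ 0 := by
    have : 0 < ‖v‖ := by linarith
    exact_mod_cast this.ne'
  set w := (starRingEnd ℂ) v / ‖v‖
  have hw : ‖w‖ = 1 := by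
    rw [norm_div, RCLike.norm_conj, Complex.norm_real, norm_norm, div_self]
    exact_mod_cast hv0
  have hwv : w * v = ‖v‖ := by
    rw [div_mul_eq_mul_div, mul_comm, Complex.mul_conj']
    field_simp
  -- The unimodular `w` rotates `F̂(ξ)` to `|F̂(ξ)|`. The terms are nonnegative and the sum is at
  -- most `0`, so each term vanishes.
  have hsum : HasSum (fun j : ℕ => F j * (1 - (w * z ^ j).re)) (1 - ‖v‖) := by
    have h1 : HasSum (fun j : ℕ => w * ((F j : ℂ) * z ^ j)) (w * v) := by
      refine HasSum.mul_left w ?_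
      have h0 := (summable_fourierC hs ξ).hasSum
      simp only [char_eq_pow] at h0
      rw [hv, fourierZ]
      simpa only [char_eq_pow] using h0
    rw [hwv] at h1
    have h2 := hF.hasSum.sub (Complex.hasSum_re h1)
    rw [Complex.ofReal_re] at h2
    have e : (fun j : ℕ => F j * (1 - (w * z ^ j).re)) =
        fun j => F j - (w * ((F j : ℂ) * z ^ j)).re := by
      funext j
      rw [mul_left_comm, Complex.re_ofReal_mul]
      ring
    rwa [e]
  have hre : ∀ j : ℕ, (w * z ^ j).re ≤ 1 := fun j => by
    refine (Complex.re_le_norm _).trans (le_of_eq ?_)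
    rw [norm_mul, norm_pow, hw, hz, one_pow, one_mul]
  have hone : ∀ j, F j ≠ 0 → w * z ^ j = 1 := by
    intro j hj
    have h1 := le_hasSum hsum j fun i _ => mul_nonneg (hF.nonneg i) (by linarith [hre i])
    have h2 : 0 < F j := lt_of_le_of_ne (hF.nonneg j) hj.symm
    have h3 : (w * z ^ j).re = 1 := by
      refine le_antisymm (hre j) ?_
      by_contra! hlt
      nlinarith [mul_pos h2 (sub_pos.2 hlt)]
    have hn : ‖w * z ^ j‖ = 1 := by rw [norm_mul, norm_pow, hw, hz, one_pow, one_mul]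
    have h4 := Complex.sq_norm (w * z ^ j)
    rw [hn, Complex.normSq_apply, h3] at h4
    apply Complex.ext
    · simpa using h3
    · simp only [Complex.one_im]
      nlinarith
  have e0 := hone k hk0
  have e1 := hone (k + 1) hk1
  have hz1 : z = 1 := by
    rw [pow_succ, ← mul_assoc, e0, one_mul] at e1
    exact e1
  have h5 : |ξ| / 2 ≤ ‖1 - z‖ := half_abs_le_norm_one_sub_exp hξ
  rw [hz1, sub_self, norm_zero] at h5
  have := abs_pos.2 hξ0
  linarith

/-- The decay `|F̂(ξ)| ≤ exp(-c |ξ|^a)` on `[-π, π]`. -/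
theorem exists_norm_fourierZ_le_exp {F : ℕ → ℝ} (hF : IsProbability F)
    (h : ∃ k, F k ≠ 0 ∧ F (k + 1) ≠ 0) {a ε C : ℝ} (ha : 0 < a) (hε : 0 < ε) (hε1 : ε < 1)
    (hre : ∀ ξ ∈ Set.Icc (-ε) ε, ε * |ξ| ^ a ≤ 1 - (fourierZ F ξ).re)
    (hC : ∀ ξ, |ξ| ≤ Real.pi → ‖1 - fourierZ F ξ‖ ≤ C * |ξ| ^ a) :
    ∃ c : ℝ, 0 < c ∧ ∀ ξ, |ξ| ≤ Real.pi → ‖fourierZ F ξ‖ ≤ Real.exp (-(c * |ξ| ^ a)) := by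
  have hs : Summable fun k => ‖(F k : ℂ)‖ := by
    simpa [Complex.norm_real] using hF.hasSum.summable.norm
  have hcont : Continuous (fourierZ F) := continuous_fourierC hs
  have hpi3 := Real.pi_gt_three
  -- In `|φ|² = 1 - 2 Re(1 - φ) + |1 - φ|²` the gain is at least `2ε|ξ|^a` and the loss at most
  -- `C²|ξ|^{2a}`. For `|ξ| ≤ ρ` the loss is at most `ε|ξ|^a`, leaving `|φ|² ≤ 1 - ε|ξ|^a`.
  set ρ := min ε ((ε / (C ^ 2 + 1)) ^ (1 / a)) with hρdef
  have hρ : 0 < ρ := by positivity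
  have hρε : ρ ≤ ε := min_le_left _ _
  have hnear : ∀ ξ, |ξ| ≤ ρ → ‖fourierZ F ξ‖ ≤ Real.exp (-(ε / 2 * |ξ| ^ a)) := by
    intro ξ hξ
    set x := |ξ| ^ a with hx
    have hx0 : 0 ≤ x := by positivity
    have h1 := hre ξ (abs_le.1 (hξ.trans hρε))
    have h2 := hC ξ (hξ.trans (by linarith))
    have h3 : C ^ 2 * x ≤ ε := by
      have h4 : x ≤ ε / (C ^ 2 + 1) := by
        have := Real.rpow_le_rpow (abs_nonneg ξ) (hξ.trans (min_le_right _ _)) ha.le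
        rwa [← Real.rpow_mul (by positivity), one_div, inv_mul_cancel₀ ha.ne', Real.rpow_one]
          at this
      rw [le_div_iff₀ (by positivity)] at h4
      nlinarith
    have h4 : ‖fourierZ F ξ‖ ^ 2 =
        1 - 2 * (1 - (fourierZ F ξ).re) + ‖1 - fourierZ F ξ‖ ^ 2 := by
      rw [Complex.sq_norm, Complex.sq_norm, Complex.normSq_apply, Complex.normSq_apply]
      simp only [Complex.sub_re, Complex.sub_im, Complex.one_re, Complex.one_im]
      ring
    have h5 : ‖1 - fourierZ F ξ‖ ^ 2 ≤ (C * x) ^ 2 := by gcongr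
    have h6 : (C * x) ^ 2 ≤ ε * x := by nlinarith
    have h7 : ‖fourierZ F ξ‖ ^ 2 ≤ Real.exp (-(ε / 2 * x)) ^ 2 := by
      rw [← Real.exp_nat_mul]
      have := Real.add_one_le_exp (-(ε * x))
      rw [show ((2 : ℕ) : ℝ) * -(ε / 2 * x) = -(ε * x) by push_cast; ring]
      linarith
    exact le_of_sq_le_sq h7 (Real.exp_pos _).le
  have hK : IsCompact {ξ : ℝ | ρ ≤ |ξ| ∧ |ξ| ≤ Real.pi} := by
    refine (isCompact_Icc (a := -Real.pi) (b := Real.pi)).of_isClosed_subset ?_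
      fun ξ hξ => abs_le.1 hξ.2
    exact (isClosed_le continuous_const continuous_abs).inter
      (isClosed_le continuous_abs continuous_const)
  obtain ⟨ξ₁, hξ₁, hmax⟩ := hK.exists_isMaxOn
    ⟨Real.pi, by rw [abs_of_pos Real.pi_pos]; linarith, by rw [abs_of_pos Real.pi_pos]⟩
    hcont.norm.continuousOn
  -- The maximum with `1/2` keeps `r` positive, so that `log r` is meaningful even if `F̂` vanishes
  -- on the compact set.
  set r := max ‖fourierZ F ξ₁‖ (1 / 2)
  have hr1 : r < 1 := max_lt
    (norm_fourierZ_lt_one hF h hξ₁.2 (abs_pos.1 (hρ.trans_le hξ₁.1))) (by norm_num)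
  have hr0 : 0 < r := lt_of_lt_of_le (by norm_num) (le_max_right _ _)
  have hlog : 0 < -Real.log r := by linarith [Real.log_neg hr0 hr1]
  have hpia : 0 < Real.pi ^ a := by positivity
  refine ⟨min (ε / 2) (-Real.log r / Real.pi ^ a), by positivity, fun ξ hξ => ?_⟩
  have hx0 : 0 ≤ |ξ| ^ a := by positivity
  rcases le_total |ξ| ρ with hle | hge
  · refine (hnear ξ hle).trans (Real.exp_le_exp.2 (neg_le_neg ?_))
    gcongr
    exact min_le_left _ _
  · have h1 : ‖fourierZ F ξ‖ ≤ r := le_trans (hmax (show ξ ∈ _ from ⟨hge, hξ⟩)) (le_max_left _ _)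
    refine h1.trans ?_
    rw [← Real.exp_log hr0, Real.exp_le_exp, Real.exp_log hr0, le_neg]
    calc min (ε / 2) (-Real.log r / Real.pi ^ a) * |ξ| ^ a
        ≤ -Real.log r / Real.pi ^ a * Real.pi ^ a := by
          gcongr
          exact min_le_right _ _
      _ = -Real.log r := by field_simp

/-! ### Increments of periodic functions with a power singularity at the origin. -/

theorem exists_shift_mem_Icc {ξ : ℝ} (hξ : |ξ| ≤ Real.pi + 1) :
    ∃ τ : ℝ, (τ = 0 ∨ τ = 2 * Real.pi ∨ τ = -(2 * Real.pi)) ∧ |ξ - τ| ≤ Real.pi ∧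
      |ξ| / 2 ≤ |ξ - τ| ∧ |ξ - τ| ≤ |ξ| := by
  have hpi := Real.pi_gt_three
  rcases le_or_gt |ξ| Real.pi with h | h
  · exact ⟨0, Or.inl rfl, by simpa using h, by simp, by simp⟩
  -- Beyond `π` one period is removed; `2π - |ξ| ≥ |ξ|/2` for `|ξ| ≤ π + 1` amounts to `π ≥ 3`.
  · rcases le_total 0 ξ with h0 | h0
    · rw [abs_of_nonneg h0] at h hξ ⊢
      have e : |ξ - 2 * Real.pi| = 2 * Real.pi - ξ := by
        rw [abs_of_nonpos] <;> linarith
      exact ⟨2 * Real.pi, by simp, by linarith, by linarith, by linarith⟩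
    · rw [abs_of_nonpos h0] at h hξ ⊢
      have e : |ξ - -(2 * Real.pi)| = 2 * Real.pi + ξ := by
        rw [abs_of_nonneg] <;> linarith
      exact ⟨-(2 * Real.pi), by simp, by linarith, by linarith, by linarith⟩

theorem half_rpow_sub_one_le {x y b : ℝ} (hx : 0 < x) (hxy : x / 2 ≤ y) (hb0 : 0 ≤ b)
    (hb1 : b ≤ 1) : y ^ (b - 1) ≤ 2 * x ^ (b - 1) := by
  have h1 : y ^ (b - 1) ≤ (x / 2) ^ (b - 1) :=
    Real.rpow_le_rpow_of_nonpos (by positivity) hxy (by linarith)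
  have h2 : (2 : ℝ) ^ (1 - b) ≤ 2 := by
    simpa using Real.rpow_le_rpow_of_exponent_le (x := 2) (by norm_num)
      (show 1 - b ≤ 1 by linarith)
  have h3 : (x / 2) ^ (b - 1) = 2 ^ (1 - b) * x ^ (b - 1) := by
    rw [Real.div_rpow hx.le (by norm_num), show b - 1 = -(1 - b) by ring,
      Real.rpow_neg (by norm_num : (0 : ℝ) ≤ 2), div_inv_eq_mul, mul_comm]
  have h4 : 0 ≤ x ^ (b - 1) := by positivity
  rw [h3] at h1
  nlinarith

/-- Bounds on a period extend to a neighbourhood of it. -/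
theorem periodic_bounds_extend {φ : ℝ → ℂ} (hφ : Function.Periodic φ (2 * Real.pi)) {A b : ℝ}
    (hA : 0 ≤ A) (hb0 : 0 < b) (hb1 : b ≤ 1)
    (h1 : ∀ ξ, |ξ| ≤ Real.pi → ‖φ ξ‖ ≤ A * |ξ| ^ b)
    (h2 : ∀ ξ, ξ ≠ 0 → |ξ| ≤ Real.pi → ∃ d, HasDerivAt φ d ξ ∧ ‖d‖ ≤ A * |ξ| ^ (b - 1)) :
    (∀ ξ, |ξ| ≤ Real.pi + 1 → ‖φ ξ‖ ≤ A * |ξ| ^ b) ∧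
    (∀ ξ, ξ ≠ 0 → |ξ| ≤ Real.pi + 1 →
      ∃ d, HasDerivAt φ d ξ ∧ ‖d‖ ≤ 2 * A * |ξ| ^ (b - 1)) := by
  have hper : ∀ τ : ℝ, (τ = 0 ∨ τ = 2 * Real.pi ∨ τ = -(2 * Real.pi)) →
      ∀ x, φ (x - τ) = φ x := by
    rintro τ (rfl | rfl | rfl) x
    · simp
    · exact hφ.sub_eq x
    · rw [sub_neg_eq_add]; exact hφ x
  constructor
  · intro ξ hξ
    obtain ⟨τ, hτ, h3, h4, h5⟩ := exists_shift_mem_Icc hξ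
    rw [← hper τ hτ]
    refine (h1 _ h3).trans ?_
    gcongr
  · intro ξ hξ0 hξ
    obtain ⟨τ, hτ, h3, h4, h5⟩ := exists_shift_mem_Icc hξ
    have hx := abs_pos.2 hξ0
    obtain ⟨d, hd, hdn⟩ := h2 (ξ - τ) (abs_pos.1 (by linarith)) h3
    refine ⟨d, ?_, ?_⟩
    · have := hd.comp_sub_const ξ τ
      simpa only [hper τ hτ] using this
    · have := half_rpow_sub_one_le hx h4 hb0.le hb1
      refine hdn.trans ?_
      calc A * |ξ - τ| ^ (b - 1) ≤ A * (2 * |ξ| ^ (b - 1)) := by gcongr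
        _ = _ := by ring

theorem norm_increment_le {φ : ℝ → ℂ} {A b R : ℝ} (hA : 0 ≤ A) (hb0 : 0 < b) (hb1 : b ≤ 1)
    (h1 : ∀ ξ, |ξ| ≤ R + 1 → ‖φ ξ‖ ≤ A * |ξ| ^ b)
    (h2 : ∀ ξ, ξ ≠ 0 → |ξ| ≤ R + 1 → ∃ d, HasDerivAt φ d ξ ∧ ‖d‖ ≤ 2 * A * |ξ| ^ (b - 1))
    {ξ h : ℝ} (hξ : |ξ| ≤ R) (hh0 : 0 < h) (hh1 : h ≤ 1) :
    ‖φ (ξ + h) - φ ξ‖ ≤ 18 * A * h ^ b * (1 + |ξ| / h) ^ (b - 1) := by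
  have hAh : 0 ≤ A * h ^ b := by positivity
  have habs : |ξ + h| ≤ |ξ| + h := by
    simpa [abs_of_pos hh0] using abs_add_le ξ h
  -- Within `2h` of the origin the size bound is applied at both endpoints: `3 + 3` multiples of `A
  -- h^b`, against a bracket at least `1/3`, give the constant `18`. Farther out the segment stays
  -- at distance at least `|ξ|/2` from `0`, and the mean value inequality applies.
  rcases le_or_gt |ξ| (2 * h) with hle | hgt
  · have h3 : ∀ η, |η| ≤ R + 1 → |η| ≤ 3 * h → ‖φ η‖ ≤ 3 * (A * h ^ b) := by
      intro η hη hη3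
      refine (h1 η hη).trans ?_
      have h3b : (3 : ℝ) ^ b ≤ 3 := by
        simpa using Real.rpow_le_rpow_of_exponent_le (x := 3) (by norm_num) hb1
      have : |η| ^ b ≤ 3 * h ^ b := by
        calc |η| ^ b ≤ (3 * h) ^ b := Real.rpow_le_rpow (abs_nonneg _) hη3 hb0.le
          _ = 3 ^ b * h ^ b := Real.mul_rpow (by norm_num) hh0.le
          _ ≤ 3 * h ^ b := by gcongr
      calc A * |η| ^ b ≤ A * (3 * h ^ b) := by gcongr
        _ = _ := by ring
    have h4 := h3 (ξ + h) (by linarith) (by linarith)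
    have h5 := h3 ξ (by linarith) (by linarith)
    have h6 : (1 : ℝ) / 3 ≤ (1 + |ξ| / h) ^ (b - 1) := by
      have h7 : 1 + |ξ| / h ≤ 3 := by
        have : |ξ| / h ≤ 2 := by rwa [div_le_iff₀ hh0]
        linarith
      have h8 := Real.rpow_le_rpow_of_nonpos (by positivity) h7 (show b - 1 ≤ 0 by linarith)
      refine le_trans ?_ h8
      have := Real.rpow_le_rpow_of_exponent_le (x := 3) (by norm_num) (show -1 ≤ b - 1 by linarith)
      rwa [Real.rpow_neg_one, ← one_div] at this
    have h9 := norm_sub_le (φ (ξ + h)) (φ ξ)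
    nlinarith [mul_le_mul_of_nonneg_left h6 hAh]
  · have hx : 0 < |ξ| := by linarith
    have hseg : ∀ t ∈ Set.Icc ξ (ξ + h), |ξ| / 2 ≤ |t| ∧ |t| ≤ R + 1 := by
      intro t ht
      have h3 : |t - ξ| ≤ h := abs_le.2 ⟨by linarith [ht.1], by linarith [ht.2]⟩
      have h4 := abs_sub_abs_le_abs_sub ξ t
      have h5 := abs_sub_abs_le_abs_sub t ξ
      rw [abs_sub_comm ξ t] at h4
      constructor <;> linarith
    have hder : ∀ t ∈ Set.Icc ξ (ξ + h), ∃ d, HasDerivAt φ d t ∧ ‖d‖ ≤ 4 * A * |ξ| ^ (b - 1) := by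
      intro t ht
      obtain ⟨h3, h4⟩ := hseg t ht
      obtain ⟨d, hd, hdn⟩ := h2 t (abs_pos.1 (by linarith)) h4
      refine ⟨d, hd, hdn.trans ?_⟩
      have := half_rpow_sub_one_le hx h3 hb0.le hb1
      calc 2 * A * |t| ^ (b - 1) ≤ 2 * A * (2 * |ξ| ^ (b - 1)) := by gcongr
        _ = _ := by ring
    choose! d hd hdn using hder
    have hmv := norm_image_sub_le_of_norm_deriv_le_segment' (f := φ) (f' := d)
      (a := ξ) (b := ξ + h) (C := 4 * A * |ξ| ^ (b - 1))
      (fun t ht => (hd t ht).hasDerivWithinAt) (fun t ht => hdn t (Set.Ico_subset_Icc_self ht))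
      (ξ + h) (Set.right_mem_Icc.2 (by linarith))
    rw [add_sub_cancel_left] at hmv
    have h3 : (|ξ| / h) ^ (b - 1) ≤ 2 * (1 + |ξ| / h) ^ (b - 1) := by
      refine half_rpow_sub_one_le (by positivity) ?_ hb0.le hb1
      have : 2 ≤ |ξ| / h := by rw [le_div_iff₀ hh0]; linarith
      linarith
    have h4 : |ξ| ^ (b - 1) * h = h ^ b * (|ξ| / h) ^ (b - 1) := by
      rw [Real.div_rpow hx.le hh0.le, Real.rpow_sub_one hh0.ne' b]
      have : h ^ b ≠ 0 := by positivity
      field_simp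
    have h5 : 0 ≤ (1 + |ξ| / h) ^ (b - 1) := by positivity
    calc ‖φ (ξ + h) - φ ξ‖ ≤ 4 * A * |ξ| ^ (b - 1) * h := hmv
      _ = 4 * A * h ^ b * (|ξ| / h) ^ (b - 1) := by rw [mul_assoc, h4]; ring
      _ ≤ 4 * A * h ^ b * (2 * (1 + |ξ| / h) ^ (b - 1)) := by gcongr
      _ = 8 * (A * h ^ b * (1 + |ξ| / h) ^ (b - 1)) := by ring
      _ ≤ 18 * (A * h ^ b * (1 + |ξ| / h) ^ (b - 1)) := by gcongr; norm_num
      _ = _ := by ring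

/-! ### From Fourier-side bounds to `ℓ¹` norms. -/

open MeasureTheory in
/-- The squared `L²` norm of a function dominated by a dilated Japanese bracket. -/
theorem integral_sq_le_of_norm_le {g : ℝ → ℂ} (hg : Continuous g) {D h r : ℝ} (hh : 0 < h)
    (hr : 1 < 2 * r) (hgb : ∀ ξ, |ξ| ≤ Real.pi → ‖g ξ‖ ≤ D * (1 + |ξ| / h) ^ (-r)) :
    ∫ x in (-Real.pi)..Real.pi, ‖g x‖ ^ 2 ≤
      D ^ 2 * (h * ∫ x : ℝ, (1 + ‖x‖) ^ (-(2 * r))) := by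
  have hpi := Real.pi_pos
  have hint : Integrable fun x : ℝ => (1 + ‖x‖) ^ (-(2 * r)) :=
    integrable_one_add_norm (by simpa using hr)
  have hint2 : Integrable fun x : ℝ => (1 + ‖x / h‖) ^ (-(2 * r)) := hint.comp_div hh.ne'
  have hscale : ∫ x : ℝ, (1 + ‖x / h‖) ^ (-(2 * r)) = h * ∫ x : ℝ, (1 + ‖x‖) ^ (-(2 * r)) := by
    rw [Measure.integral_comp_div (fun x : ℝ => (1 + ‖x‖) ^ (-(2 * r))) h, abs_of_pos hh,
      smul_eq_mul]
  rw [intervalIntegral.integral_of_le (by linarith), ← hscale, ← integral_const_mul]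
  refine le_trans (setIntegral_mono_on ?_ (hint2.const_mul (D ^ 2)).integrableOn
    measurableSet_Ioc fun x hx => ?_)
    (setIntegral_le_integral (hint2.const_mul (D ^ 2))
      (Filter.Eventually.of_forall fun x => by positivity))
  · exact (hg.norm.pow 2).integrableOn_Ioc
  · have hb := hgb x (abs_le.2 ⟨hx.1.le, hx.2⟩)
    have e : (1 + ‖x / h‖) ^ (-(2 * r)) = ((1 + |x| / h) ^ (-r)) ^ 2 := by
      rw [Real.norm_eq_abs, abs_div, abs_of_pos hh, ← Real.rpow_natCast, ← Real.rpow_mul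
        (by positivity)]
      congr 1; push_cast; ring
    rw [e, ← mul_pow]
    gcongr

theorem sum_abs_le_sqrt {f : ℕ → ℝ} (S : Finset ℕ) {D : ℝ}
    (h : (S.card : ℝ) * ∑ k ∈ S, |f k| ^ 2 ≤ D ^ 2) (hD : 0 ≤ D) : ∑ k ∈ S, |f k| ≤ D :=
  le_of_sq_le_sq (sq_sum_le_card_mul_sum_sq.trans h) hD

theorem third_le_norm_char_sub_one {N k : ℕ} (hN : 0 < N) (h1 : N ≤ k) (h2 : k ≤ 2 * N) :
    1 / 3 ≤ ‖Complex.exp (-(Complex.I * (k : ℂ) * ((1 / N : ℝ) : ℂ))) - 1‖ := by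
  have hN' : (0 : ℝ) < N := by exact_mod_cast hN
  have hk1 : 1 ≤ (k : ℝ) * (1 / N) := by
    rw [mul_one_div, le_div_iff₀ hN', one_mul]; exact_mod_cast h1
  have hk2 : (k : ℝ) * (1 / N) ≤ 2 := by
    rw [mul_one_div, div_le_iff₀ hN']; exact_mod_cast h2
  have hcos : Real.cos ((k : ℝ) * (1 / N)) ≤ 5 / 9 :=
    le_trans (Real.cos_le_cos_of_nonneg_of_le_pi zero_le_one
      (by linarith [Real.pi_gt_three]) hk1) Real.cos_one_le
  have h3 := Complex.abs_re_le_norm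
    (Complex.exp (-(Complex.I * (k : ℂ) * ((1 / N : ℝ) : ℂ))) - 1)
  rw [Complex.sub_re, char_re] at h3
  rw [Complex.one_re, abs_of_nonpos (by linarith)] at h3
  linarith

/-- Bernstein's estimate for the `ℓ¹` norm of a dyadic block of Fourier coefficients. -/
theorem sum_dyadic_block_le {f : ℕ → ℝ} (hf : Summable fun k => ‖f k‖) {A b : ℝ} (hA : 0 ≤ A)
    (hb0 : 0 < b) (hb1 : b < 1 / 2)
    (h1 : ∀ ξ, |ξ| ≤ Real.pi + 1 → ‖fourierZ f ξ‖ ≤ A * |ξ| ^ b)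
    (h2 : ∀ ξ, ξ ≠ 0 → |ξ| ≤ Real.pi + 1 →
      ∃ d, HasDerivAt (fourierZ f) d ξ ∧ ‖d‖ ≤ 2 * A * |ξ| ^ (b - 1))
    {N : ℕ} (hN : 0 < N) :
    ∑ k ∈ Finset.Ico N (2 * N), |f k| ≤
      54 * A * √(∫ x : ℝ, (1 + ‖x‖) ^ (-(2 * (1 - b)))) * (N : ℝ) ^ (-b) := by
  have hN' : (0 : ℝ) < N := by exact_mod_cast hN
  set J := ∫ x : ℝ, (1 + ‖x‖) ^ (-(2 * (1 - b)))
  have hJ : 0 ≤ J := MeasureTheory.integral_nonneg fun x => by positivity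
  set h : ℝ := 1 / N with hh
  have hh0 : 0 < h := by positivity
  have hh1 : h ≤ 1 := by
    rw [hh, div_le_one hN']; exact_mod_cast hN
  have hfc : Summable fun k => ‖(f k : ℂ)‖ := by simpa [Complex.norm_real] using hf
  -- The multiplier `e^{-ikh} - 1` of an increment with `h = 1/N` has modulus at least `1/3` on the
  -- block `[N, 2N)`, so `g` controls `f` there.
  let g : ℕ → ℂ := fun k => (f k : ℂ) * (Complex.exp (-(Complex.I * (k : ℂ) * (h : ℂ))) - 1)
  have hg : Summable fun k => ‖g k‖ := by
    refine Summable.of_nonneg_of_le (fun _ => norm_nonneg _) (fun k => ?_) (hfc.mul_right 2)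
    rw [norm_mul]
    gcongr
    refine (norm_sub_le _ _).trans ?_
    rw [norm_char, norm_one]; norm_num
  have hgφ : ∀ ξ, fourierC g ξ = fourierZ f (ξ + h) - fourierZ f ξ := fun ξ =>
    fourierC_shift hfc ξ h
  -- Square integrability of the bracket at infinity, `2(1 - b) > 1`, is what requires `b < 1/2`.
  have hint := integral_sq_le_of_norm_le (g := fourierC g) (D := 18 * A * h ^ b) (h := h)
    (r := 1 - b) (continuous_fourierC hg) hh0 (by linarith) (fun ξ hξ => by
      rw [hgφ, neg_sub]
      exact norm_increment_le hA hb0 (by linarith) h1 h2 hξ hh0 hh1)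
  have hbes := (sum_sq_le_integral hg (Finset.Ico N (2 * N))).trans hint
  refine sum_abs_le_sqrt _ ?_ (by positivity)
  have hcmp : ∑ k ∈ Finset.Ico N (2 * N), |f k| ^ 2 ≤
      9 * ∑ k ∈ Finset.Ico N (2 * N), ‖g k‖ ^ 2 := by
    rw [Finset.mul_sum]
    refine Finset.sum_le_sum fun k hk => ?_
    rw [Finset.mem_Ico] at hk
    have h3 := third_le_norm_char_sub_one hN hk.1 hk.2.le
    have h4 : |f k| * (1 / 3) ≤ ‖g k‖ := by
      rw [norm_mul, Complex.norm_real, Real.norm_eq_abs]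
      gcongr
    have h5 := pow_le_pow_left₀ (by positivity) h4 2
    rw [mul_pow] at h5
    linarith
  rw [Nat.card_Ico, show 2 * N - N = N by omega]
  have e1 : (N : ℝ) ^ (-b) = h ^ b := by
    rw [hh, one_div, Real.inv_rpow hN'.le, Real.rpow_neg hN'.le]
  -- The factor `N` from Cauchy-Schwarz cancels the factor `h` from rescaling the `L²` integral,
  -- leaving exactly `h^b = N^{-b}`.
  have e2 : (N : ℝ) * h = 1 := by rw [hh]; field_simp
  calc (N : ℝ) * ∑ k ∈ Finset.Ico N (2 * N), |f k| ^ 2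
      ≤ N * (9 * ((18 * A * h ^ b) ^ 2 * (h * J))) := by gcongr; linarith
    _ = (54 * A) ^ 2 * J * (h ^ b) ^ 2 * (N * h) := by ring
    _ = (54 * A * √J * (N : ℝ) ^ (-b)) ^ 2 := by
        rw [e1, e2, mul_pow (54 * A * √J), mul_pow (54 * A) (√J), Real.sq_sqrt hJ, mul_one]

/-- The low frequency part, by the Cauchy-Schwarz inequality. -/
theorem sum_low_block_le {f : ℕ → ℝ} (hf : Summable fun k => ‖f k‖) {B M : ℝ} (hB : 0 ≤ B)
    (hM : 0 < M) (h0 : ∀ ξ, |ξ| ≤ Real.pi → ‖fourierZ f ξ‖ ≤ B / (1 + M * |ξ|))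
    {N : ℕ} (hN : (N : ℝ) ≤ 2 * M) :
    ∑ k ∈ Finset.range N, |f k| ≤ B * √(2 * ∫ x : ℝ, (1 + ‖x‖) ^ (-(2 * 1) : ℝ)) := by
  set J := ∫ x : ℝ, (1 + ‖x‖) ^ (-(2 * 1) : ℝ)
  have hJ : 0 ≤ J := MeasureTheory.integral_nonneg fun x => by positivity
  have hfc : Summable fun k => ‖(f k : ℂ)‖ := by simpa [Complex.norm_real] using hf
  have hint := integral_sq_le_of_norm_le (g := fourierZ f) (D := B) (h := 1 / M) (r := 1)
    (continuous_fourierC hfc) (by positivity) (by norm_num) (fun ξ hξ => by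
      refine (h0 ξ hξ).trans (le_of_eq ?_)
      rw [Real.rpow_neg_one, div_eq_mul_inv]
      congr 3
      field_simp)
  have hbes := (sum_sq_le_integral hfc (Finset.range N)).trans hint
  refine sum_abs_le_sqrt _ ?_ (by positivity)
  rw [Finset.card_range]
  have hsq : ∀ k, ‖(f k : ℂ)‖ = |f k| := fun k => by rw [Complex.norm_real, Real.norm_eq_abs]
  simp only [hsq] at hbes
  calc (N : ℝ) * ∑ k ∈ Finset.range N, |f k| ^ 2
      ≤ (2 * M) * (B ^ 2 * (1 / M * J)) := by gcongr
    _ = B ^ 2 * (2 * J) := by field_simp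
    _ = (B * √(2 * J)) ^ 2 := by rw [mul_pow, Real.sq_sqrt (by positivity)]

/-- A function of frequency scale `1 / M`, which is `b`-Hölder at the origin in a differential
sense, has Fourier coefficients with `ℓ¹` norm `O(B + A M^{-b})`. -/
theorem tsum_abs_le_of_fourierZ_bounds {b : ℝ} (hb0 : 0 < b) (hb1 : b < 1 / 2) :
    ∃ K : ℝ, 0 ≤ K ∧ ∀ (f : ℕ → ℝ) (A B M : ℝ), Summable (fun k => ‖f k‖) → 0 ≤ A → 0 ≤ B →
      1 ≤ M → (∀ ξ, |ξ| ≤ Real.pi → ‖fourierZ f ξ‖ ≤ B / (1 + M * |ξ|)) →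
      (∀ ξ, |ξ| ≤ Real.pi → ‖fourierZ f ξ‖ ≤ A * |ξ| ^ b) →
      (∀ ξ, ξ ≠ 0 → |ξ| ≤ Real.pi →
        ∃ d, HasDerivAt (fourierZ f) d ξ ∧ ‖d‖ ≤ A * |ξ| ^ (b - 1)) →
      ∑' k, |f k| ≤ K * (B + A * M ^ (-b)) := by
  set J₁ := √(2 * ∫ x : ℝ, (1 + ‖x‖) ^ (-(2 * 1) : ℝ))
  set J₂ := √(∫ x : ℝ, (1 + ‖x‖) ^ (-(2 * (1 - b))))
  set q : ℝ := 2 ^ (-b)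
  have hq0 : 0 < q := by positivity
  have hq1 : q < 1 := Real.rpow_lt_one_of_one_lt_of_neg (by norm_num) (by linarith)
  have hq : 0 < 1 - q := by linarith
  have hJ₁ : 0 ≤ J₁ := Real.sqrt_nonneg _
  have hJ₂ : 0 ≤ J₂ := Real.sqrt_nonneg _
  refine ⟨J₁ + 54 * J₂ / (1 - q), by positivity, fun f A B M hf hA hB hM h0 h1 h2 => ?_⟩
  have hM0 : 0 < M := by linarith
  obtain ⟨h1', h2'⟩ := periodic_bounds_extend (fourierC_periodic _) hA hb0 (by linarith) h1 h2
  -- Coefficients below `N ~ M` use the bound with `B`; the blocks `[N 2^L, N 2^{L+1})` use the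
  -- bounds with `A` and sum geometrically with ratio `q = 2^{-b}`.
  set N := ⌈M⌉₊
  have hMN : M ≤ N := Nat.le_ceil _
  have hN0 : (0 : ℝ) < N := hM0.trans_le hMN
  have hN0' : 0 < N := by exact_mod_cast hN0
  have hN2 : (N : ℝ) ≤ 2 * M := by linarith [Nat.ceil_lt_add_one hM0.le]
  have hNb : (N : ℝ) ^ (-b) ≤ M ^ (-b) := Real.rpow_le_rpow_of_nonpos hM0 hMN (by linarith)
  have hlow := sum_low_block_le hf hB hM0 h0 hN2
  have hdy : ∀ L : ℕ, ∑ k ∈ Finset.range (N * 2 ^ L), |f k| ≤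
      B * J₁ + 54 * A * J₂ * M ^ (-b) * ∑ j ∈ Finset.range L, q ^ j := by
    intro L
    induction L with
    | zero => rwa [pow_zero, mul_one, Finset.sum_range_zero, mul_zero, add_zero]
    | succ L ih =>
      have hle : N * 2 ^ L ≤ N * 2 ^ (L + 1) := by gcongr <;> omega
      rw [← Finset.sum_range_add_sum_Ico _ hle, Finset.sum_range_succ]
      have hblock := sum_dyadic_block_le hf hA hb0 hb1 h1' h2' (N := N * 2 ^ L) (by positivity)
      rw [show 2 * (N * 2 ^ L) = N * 2 ^ (L + 1) by ring] at hblock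
      have e : ((N * 2 ^ L : ℕ) : ℝ) ^ (-b) = (N : ℝ) ^ (-b) * q ^ L := by
        push_cast
        rw [Real.mul_rpow hN0.le (by positivity), ← Real.rpow_natCast, ← Real.rpow_natCast,
          ← Real.rpow_mul (by norm_num), ← Real.rpow_mul (by norm_num), mul_comm (L : ℝ)]
      rw [e] at hblock
      have : 54 * A * J₂ * ((N : ℝ) ^ (-b) * q ^ L) ≤ 54 * A * J₂ * (M ^ (-b) * q ^ L) := by
        gcongr
      linarith
  refine Real.tsum_le_of_sum_range_le (fun k => abs_nonneg _) fun n => ?_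
  have hn : n ≤ N * 2 ^ n := (Nat.lt_two_pow_self).le.trans (Nat.le_mul_of_pos_left _ hN0')
  have hgeo : ∑ j ∈ Finset.range n, q ^ j ≤ 1 / (1 - q) := by
    rw [one_div, ← tsum_geometric_of_lt_one hq0.le hq1]
    exact (summable_geometric_of_lt_one hq0.le hq1).sum_le_tsum _ fun _ _ => by positivity
  calc ∑ k ∈ Finset.range n, |f k|
      ≤ ∑ k ∈ Finset.range (N * 2 ^ n), |f k| :=
        Finset.sum_le_sum_of_subset_of_nonneg (Finset.range_subset_range.2 hn)
          fun _ _ _ => abs_nonneg _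
    _ ≤ B * J₁ + 54 * A * J₂ * M ^ (-b) * ∑ j ∈ Finset.range n, q ^ j := hdy n
    _ ≤ B * J₁ + 54 * A * J₂ * M ^ (-b) * (1 / (1 - q)) := by gcongr
    _ = B * J₁ + (A * M ^ (-b)) * (54 * J₂ / (1 - q)) := by ring
    _ ≤ (J₁ + 54 * J₂ / (1 - q)) * (B + A * M ^ (-b)) := by
        have h3 : 0 ≤ B * (54 * J₂ / (1 - q)) := by positivity
        have h4 : 0 ≤ A * M ^ (-b) * J₁ := by positivity
        linarith

/-! ### The Ritt property from bounds on `F̂`. -/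

/-- A Fourier criterion for the Ritt property. -/
theorem mem_rittClass_of_fourierZ_bounds {F : ℕ → ℝ} (hF : IsProbability F)
    {a c C D : ℝ} (ha : 0 < a) (ha1 : a < 1) (hc : 0 < c) (hC : 0 ≤ C) (hD : 0 ≤ D)
    (hexp : ∀ ξ, |ξ| ≤ Real.pi → ‖fourierZ F ξ‖ ≤ Real.exp (-(c * |ξ| ^ a)))
    (hsub : ∀ ξ, |ξ| ≤ Real.pi → ‖1 - fourierZ F ξ‖ ≤ C * |ξ| ^ a)
    (hder : ∀ ξ, ξ ≠ 0 → |ξ| ≤ Real.pi →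
      ∃ d, HasDerivAt (fourierZ F) d ξ ∧ ‖d‖ ≤ D * |ξ| ^ (a - 1)) :
    F ∈ rittClass := by
  refine ⟨hF, ?_⟩
  have hFs : Summable fun k => ‖F k‖ := hF.hasSum.summable.norm
  -- Halving the exponent ensures `b = a/2 < 1/2` for every `a < 1`. The other half is traded for
  -- `n^{-1/2}` through `|ξ|^{a/2} = n^{-1/2} (n|ξ|^a)^{1/2}`.
  obtain ⟨K, hK0, hK⟩ := tsum_abs_le_of_fourierZ_bounds (b := a / 2) (by linarith) (by linarith)
  -- These constants collect bounds for `u^p e^{-cu}` at `u = n|ξ|^a`: `p = 1` and `1 + 1/a` for the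
  -- decay at scale `n^{-1/a}`, `p = 1/2` and `3/2` for the size and derivative bounds with exponent
  -- `a/2`.
  set K₁ : ℝ := (1 / c) ^ (1 : ℝ) + ((1 + 1 / a) / c) ^ (1 + 1 / a)
  set K₂ : ℝ := (1 / 2 / c) ^ (1 / 2 : ℝ)
  set K₃ : ℝ := C * (3 / 2 / c) ^ (3 / 2 : ℝ) + K₂
  set A₀ : ℝ := C * K₂ + D * Real.exp (c * Real.pi) * K₃
  have hK₁ : 0 ≤ K₁ := by positivity
  have hK₂ : 0 ≤ K₂ := by positivity
  have hK₃ : 0 ≤ K₃ := by positivity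
  have hA₀ : 0 ≤ A₀ := by positivity
  have hmain : ∀ n : ℕ, 1 ≤ n →
      n * ∑' k, |(convPow F n - convPow F (n + 1)) k| ≤ K * (C * K₁ + A₀) := by
    intro n hn
    have hn0 : (0 : ℝ) < n := by exact_mod_cast hn
    have hn1 : (1 : ℝ) ≤ n := by exact_mod_cast hn
    set f : ℕ → ℝ := convPow F n - convPow F (n + 1) with hf
    have hfs : Summable fun k => ‖f k‖ :=
      Summable.of_nonneg_of_le (fun _ => norm_nonneg _) (fun k => norm_sub_le _ _)
        ((summable_norm_convPow hFs n).add (summable_norm_convPow hFs (n + 1)))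
    have hφ : fourierZ f = fun ξ => fourierZ F ξ ^ n * (1 - fourierZ F ξ) := by
      funext ξ
      have h1 := fourierC_sub (f := fun k => (convPow F n k : ℂ))
        (g := fun k => (convPow F (n + 1) k : ℂ))
        (by simpa [Complex.norm_real] using summable_norm_convPow hFs n)
        (by simpa [Complex.norm_real] using summable_norm_convPow hFs (n + 1)) ξ
      rw [← fourierZ_eq, ← fourierZ_eq, fourierZ_convPow hFs, fourierZ_convPow hFs] at h1
      have h2 : fourierZ f ξ =
          fourierC (fun k => (convPow F n k : ℂ) - (convPow F (n + 1) k : ℂ)) ξ := by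
        rw [fourierZ_eq, hf]; simp
      rw [h2, h1]; ring
    have hu0 : ∀ ξ : ℝ, 0 ≤ (n : ℝ) * |ξ| ^ a := fun ξ => by positivity
    have hhalf : ∀ ξ : ℝ, |ξ| ^ (a / 2) =
        (n : ℝ) ^ (-(1 / 2) : ℝ) * ((n : ℝ) * |ξ| ^ a) ^ (1 / 2 : ℝ) := by
      intro ξ
      rw [Real.mul_rpow hn0.le (by positivity), ← Real.rpow_mul (abs_nonneg ξ), ← mul_assoc,
        ← Real.rpow_add hn0]
      norm_num
      congr 1; ring
    have hbd : ∀ ξ, |ξ| ≤ Real.pi → ‖fourierZ f ξ‖ ≤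
        C * |ξ| ^ a * Real.exp (-(c * (n * |ξ| ^ a))) := by
      intro ξ hξ
      rw [hφ, norm_mul, norm_pow, mul_comm]
      refine mul_le_mul (hsub ξ hξ) ?_ (by positivity) (by positivity)
      refine (pow_le_pow_left₀ (norm_nonneg _) (hexp ξ hξ) n).trans (le_of_eq ?_)
      rw [← Real.exp_nat_mul]
      congr 1; ring
    have h0 : ∀ ξ, |ξ| ≤ Real.pi →
        ‖fourierZ f ξ‖ ≤ C * K₁ / n / (1 + (n : ℝ) ^ (1 / a) * |ξ|) := by
      intro ξ hξ
      refine (hbd ξ hξ).trans ?_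
      set u := (n : ℝ) * |ξ| ^ a with hu
      have hu' : (n : ℝ) ^ (1 / a) * |ξ| = u ^ (1 / a) := by
        rw [hu, Real.mul_rpow hn0.le (by positivity), ← Real.rpow_mul (abs_nonneg ξ),
          mul_one_div_cancel ha.ne', Real.rpow_one]
      have hun : 0 ≤ u := hu0 ξ
      have e1 := rpow_mul_exp_neg_le one_pos hc hun
      have e2 := rpow_mul_exp_neg_le (p := 1 + 1 / a) (by positivity) hc hun
      rw [Real.rpow_add_of_nonneg hun zero_le_one (by positivity)] at e2
      rw [Real.rpow_one] at e1 e2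
      rw [hu', le_div_iff₀ (by positivity), le_div_iff₀ hn0]
      calc C * |ξ| ^ a * Real.exp (-(c * u)) * (1 + u ^ (1 / a)) * n
          = C * (u * Real.exp (-(c * u)) + u * u ^ (1 / a) * Real.exp (-(c * u))) := by
            rw [hu]; ring
        _ ≤ C * K₁ := by
            gcongr
            exact add_le_add e1 e2
    have h1 : ∀ ξ, |ξ| ≤ Real.pi →
        ‖fourierZ f ξ‖ ≤ A₀ * (n : ℝ) ^ (-(1 / 2) : ℝ) * |ξ| ^ (a / 2) := by
      intro ξ hξ
      refine (hbd ξ hξ).trans ?_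
      have e1 := rpow_mul_exp_neg_le (p := 1 / 2) (by norm_num) hc (hu0 ξ)
      have e2 : |ξ| ^ a = |ξ| ^ (a / 2) * |ξ| ^ (a / 2) := by
        rw [← Real.rpow_add_of_nonneg (abs_nonneg ξ) (by linarith) (by linarith)]
        congr 1; ring
      calc C * |ξ| ^ a * Real.exp (-(c * (n * |ξ| ^ a)))
          = C * (n : ℝ) ^ (-(1 / 2) : ℝ) * |ξ| ^ (a / 2) * (((n : ℝ) * |ξ| ^ a) ^ (1 / 2 : ℝ) *
            Real.exp (-(c * (n * |ξ| ^ a)))) := by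
            conv_lhs => enter [1, 2]; rw [e2]; enter [1]; rw [hhalf]
            ring
        _ ≤ C * (n : ℝ) ^ (-(1 / 2) : ℝ) * |ξ| ^ (a / 2) * K₂ := by gcongr
        _ = C * K₂ * (n : ℝ) ^ (-(1 / 2) : ℝ) * |ξ| ^ (a / 2) := by ring
        _ ≤ A₀ * (n : ℝ) ^ (-(1 / 2) : ℝ) * |ξ| ^ (a / 2) := by
            gcongr
            exact le_add_of_nonneg_right (by positivity)
    have h2 : ∀ ξ, ξ ≠ 0 → |ξ| ≤ Real.pi → ∃ d, HasDerivAt (fourierZ f) d ξ ∧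
        ‖d‖ ≤ A₀ * (n : ℝ) ^ (-(1 / 2) : ℝ) * |ξ| ^ (a / 2 - 1) := by
      intro ξ hξ0 hξ
      obtain ⟨d, hd, hdn⟩ := hder ξ hξ0 hξ
      have hx : 0 < |ξ| := abs_pos.2 hξ0
      refine ⟨_, by rw [hφ]; exact (hd.fun_pow n).mul (hd.const_sub 1), ?_⟩
      set v := fourierZ F ξ
      set x := |ξ| ^ a with hxa
      have hx0 : 0 ≤ x := by positivity
      have hxpi : x ≤ Real.pi := by
        calc x ≤ Real.pi ^ a := Real.rpow_le_rpow hx.le hξ ha.le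
          _ ≤ Real.pi ^ (1 : ℝ) :=
              Real.rpow_le_rpow_of_exponent_le (by linarith [Real.pi_gt_three]) ha1.le
          _ = Real.pi := Real.rpow_one _
      have hv : ‖v‖ ≤ Real.exp (-(c * x)) := hexp ξ hξ
      have hv1 : ‖v‖ ≤ 1 := hv.trans (Real.exp_le_one_iff.2 (by
        have : 0 ≤ c * x := by positivity
        linarith))
      -- Having `n - 1` factors instead of `n` costs `e^{cx}`, at most `e^{cπ}` because `x ≤ π`.
      have hvn : ‖v‖ ^ (n - 1) ≤ Real.exp (c * Real.pi) * Real.exp (-(c * (n * x))) := by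
        refine (pow_le_pow_left₀ (norm_nonneg _) hv _).trans ?_
        rw [← Real.exp_nat_mul, ← Real.exp_add, Real.exp_le_exp, Nat.cast_sub hn, Nat.cast_one]
        have : c * x ≤ c * Real.pi := by gcongr
        linarith
      -- The derivative of `φ^n (1 - φ)` is factored so that `n(1 - φ)` appears, which is
      -- `O(n|ξ|^a)`.
      have e0 : (n : ℂ) * v ^ (n - 1) * d * (1 - v) + v ^ n * -d =
          v ^ (n - 1) * d * (n * (1 - v) - v) := by
        conv_lhs => rw [← Nat.sub_add_cancel hn, pow_succ]
        rw [Nat.sub_add_cancel hn]; ring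
      have e1 : ‖(n : ℂ) * (1 - v) - v‖ ≤ C * (n * x) + 1 := by
        refine (norm_sub_le _ _).trans (add_le_add ?_ hv1)
        rw [norm_mul, Complex.norm_natCast]
        calc (n : ℝ) * ‖1 - v‖ ≤ n * (C * x) := by gcongr; exact hsub ξ hξ
          _ = C * (n * x) := by ring
      have hun : 0 ≤ (n : ℝ) * x := hu0 ξ
      have e2 := rpow_mul_exp_neg_le (p := 1 / 2) (by norm_num) hc hun
      have e3 := rpow_mul_exp_neg_le (p := 3 / 2) (by norm_num) hc hun
      have e4 : ((n : ℝ) * x) ^ (3 / 2 : ℝ) = (n * x) * (n * x) ^ (1 / 2 : ℝ) := by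
        rw [show (3 / 2 : ℝ) = 1 + 1 / 2 by norm_num,
          Real.rpow_add_of_nonneg hun (by norm_num) (by norm_num), Real.rpow_one]
      have e5 : |ξ| ^ (a - 1) =
          |ξ| ^ (a / 2 - 1) * ((n : ℝ) ^ (-(1 / 2) : ℝ) * (n * x) ^ (1 / 2 : ℝ)) := by
        rw [← hhalf, ← Real.rpow_add hx]
        congr 1; ring
      rw [e4] at e3
      calc ‖(n : ℂ) * v ^ (n - 1) * d * (1 - v) + v ^ n * -d‖
          = ‖v‖ ^ (n - 1) * ‖d‖ * ‖(n : ℂ) * (1 - v) - v‖ := by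
            rw [e0, norm_mul, norm_mul, norm_pow]
        _ ≤ (Real.exp (c * Real.pi) * Real.exp (-(c * (n * x)))) * (D * |ξ| ^ (a - 1)) *
            (C * (n * x) + 1) := by gcongr
        _ = D * Real.exp (c * Real.pi) *
            (C * ((n * x) * (n * x) ^ (1 / 2 : ℝ) * Real.exp (-(c * (n * x)))) +
              (n * x) ^ (1 / 2 : ℝ) * Real.exp (-(c * (n * x)))) *
            (n : ℝ) ^ (-(1 / 2) : ℝ) * |ξ| ^ (a / 2 - 1) := by rw [e5]; ring
        _ ≤ D * Real.exp (c * Real.pi) * K₃ * (n : ℝ) ^ (-(1 / 2) : ℝ) * |ξ| ^ (a / 2 - 1) := by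
            gcongr
            exact add_le_add (by gcongr) e2
        _ ≤ A₀ * (n : ℝ) ^ (-(1 / 2) : ℝ) * |ξ| ^ (a / 2 - 1) := by
            gcongr
            exact le_add_of_nonneg_left (by positivity)
    have h := hK f (A₀ * (n : ℝ) ^ (-(1 / 2) : ℝ)) (C * K₁ / n) ((n : ℝ) ^ (1 / a)) hfs
      (by positivity) (by positivity) (Real.one_le_rpow hn1 (by positivity)) h0 h1 h2
    -- With `M = n^{1/a}` the factor `M^{-a/2}` supplies the second `n^{-1/2}`.
    have e : (n : ℝ) ^ (-(1 / 2) : ℝ) * ((n : ℝ) ^ (1 / a)) ^ (-(a / 2)) = (n : ℝ)⁻¹ := by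
      rw [← Real.rpow_mul hn0.le, ← Real.rpow_add hn0, ← Real.rpow_neg_one]
      congr 1
      field_simp
      norm_num
    rw [mul_assoc A₀, e] at h
    calc (n : ℝ) * ∑' k, |f k| ≤ n * (K * (C * K₁ / n + A₀ * (n : ℝ)⁻¹)) := by gcongr
      _ = K * (C * K₁ + A₀) := by field_simp
  refine lt_of_le_of_lt (b := ENNReal.ofReal (K * (C * K₁ + A₀))) ?_ ENNReal.ofReal_lt_top
  refine iSup₂_le fun n hn => ?_
  have hfs : Summable fun k => ‖(convPow F n - convPow F (n + 1)) k‖ :=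
    Summable.of_nonneg_of_le (fun _ => norm_nonneg _) (fun k => norm_sub_le _ _)
      ((summable_norm_convPow hFs n).add (summable_norm_convPow hFs (n + 1)))
  have e : l1Norm (convPow F n - convPow F (n + 1)) =
      ENNReal.ofReal (∑' k, |(convPow F n - convPow F (n + 1)) k|) := by
    rw [l1Norm, ENNReal.ofReal_tsum_of_nonneg (fun k => abs_nonneg _) hfs]
    exact tsum_congr fun k => Real.enorm_eq_ofReal_abs _
  rw [e, ← ENNReal.ofReal_natCast, ← ENNReal.ofReal_mul (Nat.cast_nonneg n)]
  exact ENNReal.ofReal_le_ofReal (hmain n hn)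

/-- The criterion of order `a`, for a probability charging two consecutive integers, implies the
Ritt property. -/
theorem FourierCriterion.mem_rittClass {F : ℕ → ℝ} {a : ℝ} (ha : 0 < a) (ha1 : a < 1)
    (h : FourierCriterion a F) (hcons : ∃ k, F k ≠ 0 ∧ F (k + 1) ≠ 0) : F ∈ rittClass := by
  obtain ⟨ε, hε, hε1, D, hD, hre, hd⟩ := h.bounds
  have hs : Summable fun k => ‖(F k : ℂ)‖ := by
    simpa [Complex.norm_real] using h.isProbability.hasSum.summable.norm
  have hder : ∀ ξ, ξ ≠ 0 → |ξ| ≤ Real.pi →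
      ∃ d, HasDerivAt (fourierZ F) d ξ ∧ ‖d‖ ≤ D * |ξ| ^ (a - 1) := fun ξ hξ0 hξ => by
    obtain ⟨h1, h2⟩ := hd ξ (abs_le.1 hξ) hξ0
    exact ⟨_, h1.hasDerivAt, h2⟩
  have hF0 : fourierZ F 0 = 1 := by
    have := Complex.hasSum_ofReal.2 h.isProbability.hasSum
    simpa [fourierZ] using this.tsum_eq
  have hsub : ∀ ξ, |ξ| ≤ Real.pi → ‖1 - fourierZ F ξ‖ ≤ D / a * |ξ| ^ a := fun ξ hξ => by
    have := norm_sub_le_of_deriv_le_rpow (continuous_fourierC hs) ha hder hξ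
    rw [← fourierZ_eq, hF0] at this
    rwa [norm_sub_rev]
  obtain ⟨c, hc, hexp⟩ := exists_norm_fourierZ_le_exp h.isProbability hcons ha hε hε1 hre hsub
  exact mem_rittClass_of_fourierZ_bounds h.isProbability ha ha1 hc (by positivity) hD.le hexp hsub
    hder

end RittProbability

/-! ### The theorem. -/

theorem theorem5p5 (N : ℕ) (hN : 0 < N) (α c : Fin N → ℝ)
    (hα_mono : StrictMono α) (hα_pos : ∀ j, 0 < α j) (hα_lt : ∀ j, α j < 1)
    (hc : ∀ j, 0 < c j)
    (F P : ℕ → ℝ) (hF : RittProbability.IsProbability F)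
    (hP : Summable fun k : ℕ => (k : ℝ) * |P k|)
    (hFP : ∀ k : ℕ, 1 ≤ k → F k = (∑ j, c j * (k : ℝ) ^ (-1 - α j)) + P k) :
    RittProbability.FourierCriterion (α ⟨0, hN⟩) F ∧ F ∈ RittProbability.rittClass := by
  open RittProbability in
  set j₀ : Fin N := ⟨0, hN⟩
  have ha := hα_pos j₀
  have ha1 := hα_lt j₀
  -- `P 0` is not tied to `F 0`, so `P` is replaced by the exact remainder `Q`, for which the
  -- decomposition also holds at `k = 0`. The two agree for `k ≥ 1`, and the weight `k` hides the
  -- difference at `0`.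
  let Q : ℕ → ℝ := fun k => F k - ∑ j, c j * (k : ℝ) ^ (-1 - α j)
  have hFQ : ∀ k : ℕ, F k = (∑ j, c j * (k : ℝ) ^ (-1 - α j)) + Q k := fun k => by simp [Q]
  have hQP : ∀ k : ℕ, (k : ℝ) * |Q k| = k * |P k| := by
    intro k
    rcases Nat.eq_zero_or_pos k with rfl | hk
    · simp
    · simp [Q, hFP k hk]
  have hQ : Summable fun k : ℕ => (k : ℝ) * |Q k| := by simpa only [hQP] using hP
  have hQ0 : Summable fun k : ℕ => |Q k| := by
    refine (summable_nat_add_iff 1).1 (Summable.of_nonneg_of_le (fun _ => abs_nonneg _)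
      (fun k => ?_) ((summable_nat_add_iff 1).2 hQ))
    refine le_mul_of_one_le_left (abs_nonneg _) ?_
    push_cast
    linarith [(Nat.cast_nonneg k : (0 : ℝ) ≤ k)]
  have hlow : ∀ k : ℕ, c j₀ * (k : ℝ) ^ (-1 - α j₀) ≤ F k + |Q k| := by
    intro k
    have h1 := Finset.single_le_sum (f := fun j => c j * (k : ℝ) ^ (-1 - α j))
      (fun j _ => mul_nonneg (hc j).le (by positivity)) (Finset.mem_univ j₀)
    have h2 := neg_abs_le (Q k)
    rw [hFQ k]
    linarith
  have hcons := exists_consecutive_ne_zero ha ha1 (hc j₀) hQ hlow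
  obtain ⟨ε, hε, hε1, hre⟩ := exists_le_one_sub_re_fourierZ hF ha ha1 (hc j₀) hQ0 hQ hlow
  obtain ⟨C, hC, hd⟩ := exists_deriv_fourierZ_bound (c := c) ha ha1.le
    (fun j => hα_mono.monotone (Fin.mk_le_of_le_val (Nat.zero_le _))) hα_lt hQ0 hQ hFQ
  have hcrit : FourierCriterion (α j₀) F :=
    ⟨hF, isAperiodic_of_consecutive hcons,
      ε, hε, hε1, C, hC, hre, fun ξ hξ hξ0 => hd ξ (abs_le.2 hξ) hξ0⟩
  exact ⟨hcrit, hcrit.mem_rittClass ha ha1 hcons⟩
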